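/- Let $\mathbb{D}$ be the open unit disc, $\mathcal{H}(\mathbb{D})$ the analytic functions in $\mathbb{D}$, and $m$ the Lebesgue area measure. Write $H^\infty_\alpha$ for the set of $f\in\mathcal{H}(\mathbb{D})$ with $\sup_{z\in\mathbb{D}}|f(z)|(1-|z|^2)^\alpha<\infty$, and let $\mathcal{B}=\{f\in\mathcal{H}(\mathbb{D}): f'\in H^\infty_1\}$ be the Bloch space. For $0<p<\infty$ and $f\in\mathcal{H}(\mathbb{D})$ put $\|f\|_{H^p}^p=\lim_{r\to1^-}\frac1{2\pi}\int_0^{2\pi}|f(re^{i\theta})|^p\,d\theta\in[0,\infty]$. Let $\mathrm{BMOA}$ be the set of $f\in\mathcal{H}(\mathbb{D})$ with $\sup_{a\in\mathbb{D}}\|f\circ\varphi_a-f(a)\|_{H^2}<\infty$, where $\varphi_a(z)=(a-z)/(1-\overline{a}z)$. A positive Borel measure $\mu$ on $\mathbb{D}$ is a Carleson measure if for each $0<p<\infty$ there is a constant $0<C<\infty$ such that $\int_{\mathbb{D}}|f|^p\,d\mu\le C\,\|f\|_{H^p}^p$ for all $f\in\mathcal{H}(\mathbb{D})$. Let $\varrho_p(z,w)=|w-z|/|1-\overline{w}z|$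 be the pseudo-hyperbolic distance and $\Delta_p(z,\delta)=\{w\in\mathbb{D}:\varrho_p(z,w)<\delta\}$. A (finite or infinite) sequence $\{z_n\}\subset\mathbb{D}$ is uniformly separated if the hyperbolic distances $\frac12\log\frac{1+\varrho_p(z_n,z_k)}{1-\varrho_p(z_n,z_k)}$, $n\neq k$, are bounded below by a positive constant and $\sum_n(1-|z_n|)\delta_{z_n}$ is a Carleson measure, where $\delta_{z_n}$ is the Dirac measure at $z_n$. **Theorem.** Let $A\in\mathcal{H}(\mathbb{D})$, and let $f_1,f_2\in\mathcal{B}$ be linearly independent solutions of $f''+Af=0$ in $\mathbb{D}$. Suppose that there are $0<\delta<1$ and a finite or infinite sequence $\{z_n\}\subset\mathbb{D}$ such that the discs $\Delta_p(z_n,\delta)$ are pairwise disjoint and $$\inf\Big\{|f_1(z)|+|f_2(z)| : z\in\mathbb{D}\setminus\bigcup_n\Delta_p(z_n,\delta)\Big\}>0.$$ Then $A\in H^\infty_2$. If moreover $f_1,f_2\in\mathrm{BMOA}$ and the sequence $\{z_n\}$ is uniformly separated, then $|A(z)|^2(1-|z|^2)^3\,dm(z)$ is a Carleson measure. -/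

import Mathlib

open Set MeasureTheory Metric
open scoped ENNReal NNReal ComplexConjugate

namespace DiscODE

noncomputable section

/-- The open unit disc of the complex plane. -/
abbrev 𝔻 : Set ℂ := ball (0 : ℂ) 1

/-- `f` is analytic in the unit disc (values outside the disc are irrelevant). -/
def IsAnalytic (f : ℂ → ℂ) : Prop := AnalyticOnNhd ℂ f 𝔻

/-- The growth space `H^∞_α`: analytic functions in the disc for which
`|f(z)| (1 - |z|²)^α` is bounded. -/
def MemHInfty (α : ℝ) (f : ℂ → ℂ) : Prop :=
  IsAnalytic f ∧ ∃ M : ℝ, ∀ z ∈ 𝔻, ‖f z‖ * (1 - ‖z‖ ^ 2) ^ α ≤ M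

/-- The Bloch space: analytic functions in the disc with `f' ∈ H^∞_1`. -/
def MemBloch (f : ℂ → ℂ) : Prop := IsAnalytic f ∧ MemHInfty 1 (deriv f)

/-- `f` is a solution, in the unit disc, of `f'' + A f = 0`. -/
def IsSolution (A f : ℂ → ℂ) : Prop :=
  IsAnalytic f ∧ ∀ z ∈ 𝔻, deriv (deriv f) z + A z * f z = 0

/-- `f₁` and `f₂` are linearly independent over `ℂ` as functions on the disc. -/
def LinIndep (f₁ f₂ : ℂ → ℂ) : Prop :=
  LinearIndependent ℂ ![𝔻.domRestrict f₁, 𝔻.domRestrict f₂]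

/-- The pseudo-hyperbolic distance `|w - z| / |1 - w̄ z|`. -/
def pseudoDist (z w : ℂ) : ℝ := ‖w - z‖ / ‖1 - conj w * z‖

/-- The hyperbolic distance `(1/2) log ((1 + ρ) / (1 - ρ))`, with `ρ` the pseudo-hyperbolic one. -/
def hypDist (z w : ℂ) : ℝ :=
  (1 / 2) * Real.log ((1 + pseudoDist z w) / (1 - pseudoDist z w))

/-- The pseudo-hyperbolic disc of centre `z` and radius `δ`. -/
def pseudoDisc (z : ℂ) (δ : ℝ) : Set ℂ := {w ∈ 𝔻 | pseudoDist z w < δ}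

/-- The automorphism `z ↦ (a - z) / (1 - ā z)` of the disc. -/
def discAut (a z : ℂ) : ℂ := (a - z) / (1 - conj a * z)

/-- The integral mean `(1/2π) ∫₀^{2π} |f(r e^{iθ})|^p dθ`. -/
def integralMean (p : ℝ) (f : ℂ → ℂ) (r : ℝ) : ℝ≥0∞ :=
  (ENNReal.ofReal (2 * Real.pi))⁻¹ * ∫⁻ θ in Icc 0 (2 * Real.pi), ‖f (circleMap 0 r θ)‖ₑ ^ p

/-- The `p`-th power of the `H^p` norm of an analytic function in the disc, in `[0, ∞]`.
The integral means increase with the radius, so the supremum is the limit as `r → 1⁻`. -/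
def hardyNormPow (p : ℝ) (f : ℂ → ℂ) : ℝ≥0∞ :=
  ⨆ r ∈ Ico (0 : ℝ) 1, integralMean p f r

/-- `μ` (as a measure on the disc) is a Carleson measure: for each `0 < p < ∞` there is
`0 < C < ∞` with `∫_𝔻 |f|^p dμ ≤ C ‖f‖_{H^p}^p` for every analytic `f` in the disc. -/
def IsCarleson (μ : Measure ℂ) : Prop :=
  ∀ p : ℝ, 0 < p → ∃ C : ℝ≥0, 0 < C ∧ ∀ f : ℂ → ℂ, IsAnalytic f →
    ∫⁻ z in 𝔻, ‖f z‖ₑ ^ p ∂μ ≤ C * hardyNormPow p f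

/-- The space `BMOA`: analytic functions `f` in the disc such that the `H²` norms of
`z ↦ f (φ_a z) - f a`, with `φ_a` the automorphism `discAut a`, are bounded for `a ∈ 𝔻`. -/
def MemBMOA (f : ℂ → ℂ) : Prop :=
  IsAnalytic f ∧ (⨆ a ∈ 𝔻, hardyNormPow 2 (fun z => f (discAut a z) - f a)) < ∞

/-- The finite or infinite sequence `z` of points of the disc is uniformly separated: it is
separated in the hyperbolic metric and `∑ (1 - |z_n|) δ_{z_n}` is a Carleson measure. -/
def UniformlySeparated {ι : Type*} (z : ι → ℂ) : Prop :=
  (∃ η : ℝ, 0 < η ∧ ∀ i j, i ≠ j → η ≤ hypDist (z i) (z j)) ∧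
    IsCarleson (Measure.sum fun i => ENNReal.ofReal (1 - ‖z i‖) • Measure.dirac (z i))

/-- The measure `|A(z)|² (1 - |z|²)³ dm(z)` on the disc, with `m` the Lebesgue area measure. -/
def coeffMeasure (A : ℂ → ℂ) : Measure ℂ :=
  (volume.restrict 𝔻).withDensity fun z => ENNReal.ofReal (‖A z‖ ^ 2 * (1 - ‖z‖ ^ 2) ^ 3)

end

end DiscODE

open DiscODE

/-! Off the discs the lower bound on `|f₁| + |f₂|` turns the equation into `|A| ≲ |f₁''| + |f₂''|`,
so estimates for second derivatives pass to `A` there. For Bloch functions Cauchy's estimate bounds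
`|f''| (1 - |z|²)²`. The discs are open and disjoint, so the frontier of each lies off all of them,
and the maximum principle for `A` carries the bound inside, `1 - |z|²` being essentially constant on
one disc (`memHInfty_of_bound_off_pseudoDiscs`).

For the Carleson property it is enough to bound the integrals of `|A|² (1 - |z|²)³` against `P_a(z)
= (1 - |a|²) / |1 - ā z|²` uniformly in `a` (`isCarleson_coeffMeasure`). Off the discs this reduces
to `|f''|² (1 - |z|²)³` with `f ∈ BMOA`, where the substitution `φ_a` leads to Littlewood–Paley
inequalities for `f ∘ φ_a - f(a)` (`exists_poisson_bound_of_memBMOA`). On the disc about `z_n` the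
growth of `A` and Harnack-type comparisons leave a multiple of `(1 - |z_n|) P_a(z_n)`; the sum over
`n` is bounded by testing the Carleson condition for the sequence on `1 / (1 - ā z)`.

The passage from bounded Poisson integrals to the embedding, for all `p` at once, is a potential
argument (`lintegral_potential_le`). Point masses `cᵢ` at `wᵢ` have the potential `v(z) = ∑ cᵢ (1 -
|z|²) / |1 - z̄ wᵢ|²`, which is bounded by hypothesis and satisfies `-Δv = 4 ∑ cᵢ (1 - |wᵢ|²) / |1 -
w̄ᵢ z|⁴`. Since `log |f|` is subharmonic, `Δ(|f|^p e^{-v}) ≥ |f|^p e^{-v} (-Δv)`, and Green's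
formula with weight `1 - |z|²` bounds the integral of the right side by the Hardy norm. By the
sub-mean value property `|A|² (1 - |z|²)²` is dominated by such a sum, the masses being those of the
measure itself on the cells of a hyperbolic partition.

Green's formula is proved after pulling back by `exp` to the left half-plane: circles become
vertical segments, the Laplacian is only rescaled, and periodicity cancels the contributions of the
horizontal sides. -/

/-! ### Pseudo-hyperbolic geometry and Harnack-type comparisons -/

lemma mem_disc_iff {z : ℂ} : z ∈ 𝔻 ↔ ‖z‖ < 1 := by simp

lemma one_sub_normSq_pos {z : ℂ} (hz : z ∈ 𝔻) : 0 < 1 - ‖z‖ ^ 2 := by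
  have := mem_disc_iff.1 hz
  nlinarith [norm_nonneg z]

lemma one_sub_norm_le_norm_one_sub {a z : ℂ} (ha : ‖a‖ ≤ 1) : 1 - ‖z‖ ≤ ‖1 - conj a * z‖ := by
  have h1 : ‖(1 : ℂ)‖ - ‖conj a * z‖ ≤ ‖1 - conj a * z‖ := norm_sub_norm_le _ _
  rw [norm_mul, RCLike.norm_conj, norm_one] at h1
  nlinarith [norm_nonneg z, norm_nonneg a]

lemma norm_one_sub_pos {a z : ℂ} (ha : ‖a‖ ≤ 1) (hz : z ∈ 𝔻) : 0 < ‖1 - conj a * z‖ := by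
  have := mem_disc_iff.1 hz
  linarith [one_sub_norm_le_norm_one_sub (z := z) ha]

lemma one_sub_ne_zero {a z : ℂ} (ha : ‖a‖ ≤ 1) (hz : z ∈ 𝔻) : 1 - conj a * z ≠ 0 :=
  norm_pos_iff.1 (norm_one_sub_pos ha hz)

lemma norm_one_sub_conj_comm (z w : ℂ) : ‖1 - conj w * z‖ = ‖1 - conj z * w‖ := by
  rw [← RCLike.norm_conj (1 - conj w * z)]
  simp [mul_comm]

/-- This identity shows that the pseudo-hyperbolic distance is `1` when one point lies on the unit
circle, and it computes `1 - |φ_a|²`. -/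
lemma norm_one_sub_sq_sub (z w : ℂ) :
    ‖1 - conj w * z‖ ^ 2 - ‖w - z‖ ^ 2 = (1 - ‖z‖ ^ 2) * (1 - ‖w‖ ^ 2) := by
  simp only [Complex.sq_norm, Complex.normSq_apply, Complex.sub_re, Complex.sub_im, Complex.mul_re,
    Complex.mul_im, Complex.conj_re, Complex.conj_im, Complex.one_re, Complex.one_im]
  ring

/-- Since `1 - w̄ z = (1 - |z|²) - conj (w - z) z`. With it, `|w - z| < δ |1 - w̄ z|` can be solved
for `|w - z|`, which gives the Euclidean radius `δ / (1 - δ) * (1 - |z|²)`. -/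
lemma norm_one_sub_conj_le (z w : ℂ) (hz : ‖z‖ ≤ 1) :
    ‖1 - conj w * z‖ ≤ (1 - ‖z‖ ^ 2) + ‖w - z‖ := by
  have h : 1 - conj w * z = ((1 - ‖z‖ ^ 2 : ℝ) : ℂ) - conj (w - z) * z := by
    have := Complex.conj_mul' z
    push_cast
    rw [map_sub, sub_mul, this]
    ring
  rw [h]
  refine (norm_sub_le _ _).trans ?_
  rw [Complex.norm_real, norm_mul, RCLike.norm_conj, Real.norm_of_nonneg (by nlinarith [norm_nonneg z])]
  nlinarith [norm_nonneg (w - z)]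

lemma norm_sub_lt_of_mem_pseudoDisc {z w : ℂ} {δ : ℝ} (hz : z ∈ 𝔻) (hw : w ∈ pseudoDisc z δ) :
    ‖w - z‖ < δ * ‖1 - conj w * z‖ := by
  have h := hw.2
  rw [pseudoDist, div_lt_iff₀] at h
  · exact h
  · exact norm_one_sub_pos (mem_disc_iff.1 hw.1).le hz

lemma mem_pseudoDisc_symm {z w : ℂ} {δ : ℝ} (hz : z ∈ 𝔻) (hw : w ∈ pseudoDisc z δ) :
    z ∈ pseudoDisc w δ := by
  refine ⟨hz, ?_⟩
  have h := hw.2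
  rwa [pseudoDist, norm_sub_rev, norm_one_sub_conj_comm] at h

lemma mem_pseudoDisc_self {z : ℂ} {δ : ℝ} (hδ : 0 < δ) (hz : z ∈ 𝔻) : z ∈ pseudoDisc z δ :=
  ⟨hz, by simpa [pseudoDist] using hδ⟩

lemma norm_sub_le_of_mem_pseudoDisc {z w : ℂ} {δ : ℝ} (hδ₀ : 0 < δ) (hδ : δ < 1) (hz : z ∈ 𝔻)
    (hw : w ∈ pseudoDisc z δ) : ‖w - z‖ ≤ δ / (1 - δ) * (1 - ‖z‖ ^ 2) := by
  have h1 := norm_sub_lt_of_mem_pseudoDisc hz hw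
  have h2 := norm_one_sub_conj_le z w (mem_disc_iff.1 hz).le
  rw [div_mul_eq_mul_div, le_div_iff₀ (by linarith)]
  nlinarith

lemma norm_sub_le_of_mem_pseudoDisc' {z w : ℂ} {δ : ℝ} (hδ₀ : 0 < δ) (hδ : δ < 1) (hz : z ∈ 𝔻)
    (hw : w ∈ pseudoDisc z δ) : ‖w - z‖ ≤ δ / (1 - δ) * (1 - ‖w‖ ^ 2) := by
  rw [norm_sub_rev]
  exact norm_sub_le_of_mem_pseudoDisc hδ₀ hδ hw.1 (mem_pseudoDisc_symm hz hw)

/-- The Harnack constant of a pseudo-hyperbolic disc of radius `δ`. -/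
noncomputable def harnackConst (δ : ℝ) : ℝ := 1 + 2 * (δ / (1 - δ))

lemma one_le_harnackConst {δ : ℝ} (hδ₀ : 0 < δ) (hδ : δ < 1) : 1 ≤ harnackConst δ := by
  have : 0 < δ / (1 - δ) := div_pos hδ₀ (by linarith)
  unfold harnackConst; linarith

/-- The `2` in `harnackConst` comes from `|w|² - |z|² ≤ 2 |w - z|`. -/
lemma one_sub_normSq_le_of_mem_pseudoDisc {z w : ℂ} {δ : ℝ} (hδ₀ : 0 < δ) (hδ : δ < 1) (hz : z ∈ 𝔻)
    (hw : w ∈ pseudoDisc z δ) : 1 - ‖z‖ ^ 2 ≤ harnackConst δ * (1 - ‖w‖ ^ 2) := by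
  have h1 := norm_sub_le_of_mem_pseudoDisc' hδ₀ hδ hz hw
  have h2 : ‖w‖ - ‖z‖ ≤ ‖w - z‖ := norm_sub_norm_le _ _
  have h3 := mem_disc_iff.1 hz
  have h4 := mem_disc_iff.1 hw.1
  have h5 := norm_nonneg z
  have h6 := norm_nonneg w
  have h7 := norm_nonneg (w - z)
  have : (‖w‖ - ‖z‖) * (‖w‖ + ‖z‖) ≤ 2 * ‖w - z‖ := by
    rcases le_total ‖w‖ ‖z‖ with h | h <;> nlinarith
  unfold harnackConst
  nlinarith

/-- The same constant serves here because `1 - |w|² ≤ 2 (1 - |w|) ≤ 2 |1 - ā w|`. -/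
lemma norm_one_sub_le_of_mem_pseudoDisc {a z w : ℂ} {δ : ℝ} (hδ₀ : 0 < δ) (hδ : δ < 1)
    (ha : ‖a‖ ≤ 1) (hz : z ∈ 𝔻) (hw : w ∈ pseudoDisc z δ) :
    ‖1 - conj a * z‖ ≤ harnackConst δ * ‖1 - conj a * w‖ := by
  have h1 := norm_sub_le_of_mem_pseudoDisc' hδ₀ hδ hz hw
  have h2 : ‖1 - conj a * z‖ ≤ ‖1 - conj a * w‖ + ‖w - z‖ := by
    have : 1 - conj a * z = (1 - conj a * w) + conj a * (w - z) := by ring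
    rw [this]
    refine (norm_add_le _ _).trans ?_
    rw [norm_mul, RCLike.norm_conj]
    nlinarith [norm_nonneg (w - z)]
  have h3 := one_sub_norm_le_norm_one_sub (z := w) ha
  have h4 := mem_disc_iff.1 hw.1
  have h5 : 0 < δ / (1 - δ) := div_pos hδ₀ (by linarith)
  have h6 : 1 - ‖w‖ ^ 2 ≤ 2 * ‖1 - conj a * w‖ := by nlinarith [norm_nonneg w]
  unfold harnackConst
  nlinarith

lemma isOpen_pseudoDisc {z : ℂ} {δ : ℝ} (hz : z ∈ 𝔻) : IsOpen (pseudoDisc z δ) := by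
  have : ContinuousOn (fun w => pseudoDist z w) 𝔻 := by
    unfold pseudoDist
    refine ContinuousOn.div (by fun_prop) (by fun_prop) fun w hw => ?_
    exact (norm_one_sub_pos (mem_disc_iff.1 hw).le hz).ne'
  exact this.isOpen_inter_preimage isOpen_ball isOpen_Iio

/-- The closure cannot reach the unit circle, where `|1 - w̄ z| = |w - z|` would contradict `δ < 1`.
The condition is written without division so that it is closed in the whole plane. -/
lemma closure_pseudoDisc_subset {z : ℂ} {δ : ℝ} (hδ : δ < 1) (hz : z ∈ 𝔻) :
    closure (pseudoDisc z δ) ⊆ {w ∈ 𝔻 | ‖w - z‖ ≤ δ * ‖1 - conj w * z‖} := by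
  have hcl : IsClosed {w : ℂ | ‖w‖ ≤ 1 ∧ ‖w - z‖ ≤ δ * ‖1 - conj w * z‖} := by
    refine IsClosed.and ?_ ?_
    · exact isClosed_le continuous_norm continuous_const
    · exact isClosed_le (by fun_prop) (by fun_prop)
  intro w hw
  have h : w ∈ {w : ℂ | ‖w‖ ≤ 1 ∧ ‖w - z‖ ≤ δ * ‖1 - conj w * z‖} :=
    closure_minimal (fun v hv => show _ ∧ _ from ⟨(mem_disc_iff.1 hv.1).le,
      (norm_sub_lt_of_mem_pseudoDisc hz hv).le⟩) hcl hw
  refine ⟨mem_disc_iff.2 (lt_of_le_of_ne h.1 fun h1 => ?_), h.2⟩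
  have h2 := norm_one_sub_sq_sub z w
  rw [h1] at h2
  have h3 : ‖1 - conj w * z‖ = ‖w - z‖ := by
    rw [← sq_eq_sq₀ (norm_nonneg _) (norm_nonneg _)]; linarith
  have h4 := norm_one_sub_pos h.1 hz
  have := h.2
  rw [← h3] at this
  nlinarith

/-! ### Growth of the coefficient -/

/-- The derivative of a function in `H^∞_α` (`α` a natural number) is in `H^∞_{α+1}`. -/
lemma exists_deriv_bound {g : ℂ → ℂ} (hg : IsAnalytic g) {n : ℕ} {M : ℝ}
    (hM : ∀ z ∈ 𝔻, ‖g z‖ * (1 - ‖z‖ ^ 2) ^ n ≤ M) :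
    ∃ M' : ℝ, ∀ z ∈ 𝔻, ‖deriv g z‖ * (1 - ‖z‖ ^ 2) ^ (n + 1) ≤ M' := by
  have hM0 : 0 ≤ M := le_trans (by simp) (hM 0 (by simp))
  -- Cauchy's estimate is used on the disc of radius `d / 4`, with `d = 1 - |z|²`, where `1 - |w|²`
  -- is still at least `d / 4`: one factor `4` for the radius and `n` for the weight.
  refine ⟨4 ^ (n + 1) * M, fun z hz => ?_⟩
  have hz1 := mem_disc_iff.1 hz
  have hz2 := one_sub_normSq_pos hz
  set d := 1 - ‖z‖ ^ 2 with hd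
  have hr : 0 < d / 4 := by linarith
  have hsub : ∀ w ∈ closedBall z (d / 4), w ∈ 𝔻 ∧ d / 4 ≤ 1 - ‖w‖ ^ 2 := by
    intro w hw
    rw [mem_closedBall, dist_eq_norm] at hw
    have h1 : ‖w‖ - ‖z‖ ≤ ‖w - z‖ := norm_sub_norm_le _ _
    have h3 : d ≤ 2 * (1 - ‖z‖) := by rw [hd]; nlinarith [norm_nonneg z]
    have h4 : ‖w‖ ≤ 1 - d / 4 := by linarith
    refine ⟨mem_disc_iff.2 (by linarith), ?_⟩
    nlinarith [norm_nonneg w]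
  have hcauchy : ‖deriv g z‖ ≤ (M / (d / 4) ^ n) / (d / 4) := by
    refine Complex.norm_deriv_le_of_forall_mem_sphere_norm_le hr ?_ fun w hw => ?_
    · refine DifferentiableOn.diffContOnCl ?_
      intro w hw
      rw [closure_ball _ hr.ne'] at hw
      exact (hg w (hsub w hw).1).differentiableAt.differentiableWithinAt
    · obtain ⟨h1, h2⟩ := hsub w (sphere_subset_closedBall hw)
      rw [le_div_iff₀ (by positivity)]
      refine le_trans ?_ (hM w h1)
      gcongr
  calc ‖deriv g z‖ * d ^ (n + 1) ≤ (M / (d / 4) ^ n) / (d / 4) * d ^ (n + 1) := by gcongr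
    _ = 4 ^ (n + 1) * M := by
      rw [div_pow, pow_succ 4, pow_succ d]; field_simp

lemma memHInfty_natCast {n : ℕ} {f : ℂ → ℂ} : MemHInfty n f ↔
    IsAnalytic f ∧ ∃ M : ℝ, ∀ z ∈ 𝔻, ‖f z‖ * (1 - ‖z‖ ^ 2) ^ n ≤ M := by
  simp [MemHInfty, Real.rpow_natCast]

lemma exists_deriv_deriv_bound {f : ℂ → ℂ} (hf : MemBloch f) :
    ∃ M : ℝ, ∀ z ∈ 𝔻, ‖deriv (deriv f) z‖ * (1 - ‖z‖ ^ 2) ^ 2 ≤ M := by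
  obtain ⟨h, M, hM⟩ := hf.2
  exact exists_deriv_bound (n := 1) h (M := M) (by simpa using hM)

/-- Adding the moduli of the two equations gives `|A| (|f₁| + |f₂|) = |f₁''| + |f₂''|`. -/
lemma mul_norm_coeff_le {A f₁ f₂ : ℂ → ℂ} (hf₁ : IsSolution A f₁) (hf₂ : IsSolution A f₂)
    {c : ℝ} {w : ℂ} (hw : w ∈ 𝔻) (h : c ≤ ‖f₁ w‖ + ‖f₂ w‖) :
    c * ‖A w‖ ≤ ‖deriv (deriv f₁) w‖ + ‖deriv (deriv f₂) w‖ := by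
  have h1 : deriv (deriv f₁) w = -(A w * f₁ w) := eq_neg_of_add_eq_zero_left (hf₁.2 w hw)
  have h2 : deriv (deriv f₂) w = -(A w * f₂ w) := eq_neg_of_add_eq_zero_left (hf₂.2 w hw)
  rw [h1, h2, norm_neg, norm_neg, norm_mul, norm_mul]
  nlinarith [norm_nonneg (A w)]

lemma memHInfty_of_bound_off_pseudoDiscs {A : ℂ → ℂ} (hA : IsAnalytic A) {ι : Type*} {z : ι → ℂ}
    (hz : ∀ i, z i ∈ 𝔻) {δ : ℝ} (hδ₀ : 0 < δ) (hδ₁ : δ < 1)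
    (hdisj : Pairwise fun i j => Disjoint (pseudoDisc (z i) δ) (pseudoDisc (z j) δ)) {M : ℝ}
    (hM : ∀ w ∈ 𝔻 \ ⋃ i, pseudoDisc (z i) δ, ‖A w‖ * (1 - ‖w‖ ^ 2) ^ 2 ≤ M) :
    MemHInfty 2 A := by
  have := (memHInfty_natCast (n := 2) (f := A))
  rw [show ((2 : ℕ) : ℝ) = 2 by norm_num] at this
  rw [this]
  -- The comparisons hold on open pseudo-discs; a slightly larger radius makes them available on the
  -- frontier as well.
  set δ' := (1 + δ) / 2 with hδ'
  have hδ'0 : 0 < δ' := by linarith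
  have hδ'1 : δ' < 1 := by linarith
  have hsubset : ∀ i, closure (pseudoDisc (z i) δ) ⊆ pseudoDisc (z i) δ' := by
    intro i w hw
    obtain ⟨h1, h2⟩ := closure_pseudoDisc_subset hδ₁ (hz i) hw
    have h3 := norm_one_sub_pos (mem_disc_iff.1 h1).le (hz i)
    refine ⟨h1, ?_⟩
    rw [pseudoDist, div_lt_iff₀ h3]
    nlinarith
  set K := harnackConst δ' with hK
  have hK1 : 1 ≤ K := one_le_harnackConst hδ'0 hδ'1
  -- The weight is compared twice, from a frontier point to the centre and from the centre to `w`,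
  -- each time at the cost of `K ^ 2`.
  refine ⟨hA, K ^ 4 * |M|, fun w hw => ?_⟩
  by_cases hwU : w ∈ ⋃ i, pseudoDisc (z i) δ
  · obtain ⟨i, hi⟩ := mem_iUnion.1 hwU
    set d := 1 - ‖z i‖ ^ 2 with hd
    have hd0 : 0 < d := one_sub_normSq_pos (hz i)
    have hmax : ‖A w‖ ≤ |M| / (d / K) ^ 2 := by
      refine Complex.norm_le_of_forall_mem_frontier_norm_le (U := pseudoDisc (z i) δ)
        (isBounded_ball.subset fun v hv => hv.1) ?_ ?_ (subset_closure hi)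
      · refine DifferentiableOn.diffContOnCl fun v hv => ?_
        exact (hA v (hsubset i hv).1).differentiableAt.differentiableWithinAt
      · intro v hv
        have hvD := hsubset i (frontier_subset_closure hv)
        have hnot : v ∉ ⋃ j, pseudoDisc (z j) δ := by
          rintro hvj
          obtain ⟨j, hj⟩ := mem_iUnion.1 hvj
          rcases eq_or_ne i j with rfl | hij
          · rw [(isOpen_pseudoDisc (hz i)).frontier_eq] at hv
            exact hv.2 hj
          · exact ((hdisj hij).closure_left (isOpen_pseudoDisc (hz j))).le_bot
              ⟨frontier_subset_closure hv, hj⟩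
        have h1 := hM v ⟨hvD.1, hnot⟩
        have h2 := one_sub_normSq_le_of_mem_pseudoDisc hδ'0 hδ'1 (hz i) hvD
        rw [le_div_iff₀ (by positivity)]
        refine le_trans ?_ (h1.trans (le_abs_self M))
        gcongr
        rw [div_le_iff₀ (by positivity), mul_comm]
        exact h2
    have hiw := mem_pseudoDisc_symm (hz i) (hsubset i (subset_closure hi))
    have h3 := one_sub_normSq_le_of_mem_pseudoDisc hδ'0 hδ'1 hw hiw
    have h4 := one_sub_normSq_pos hw
    calc ‖A w‖ * (1 - ‖w‖ ^ 2) ^ 2 ≤ |M| / (d / K) ^ 2 * (K * d) ^ 2 := by gcongr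
      _ = K ^ 4 * |M| := by field_simp
  · refine (hM w ⟨hw, hwU⟩).trans ((le_abs_self M).trans ?_)
    exact le_mul_of_one_le_left (abs_nonneg M) (one_le_pow₀ hK1)

lemma memHInfty_coeff {A f₁ f₂ : ℂ → ℂ} (hA : IsAnalytic A)
    (hf₁ : IsSolution A f₁) (hf₂ : IsSolution A f₂)
    (hB₁ : MemBloch f₁) (hB₂ : MemBloch f₂)
    {ι : Type*} {z : ι → ℂ} (hz : ∀ i, z i ∈ 𝔻)
    {δ : ℝ} (hδ₀ : 0 < δ) (hδ₁ : δ < 1)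
    (hdisj : Pairwise fun i j => Disjoint (pseudoDisc (z i) δ) (pseudoDisc (z j) δ))
    {c : ℝ} (hc : 0 < c) (hlower : ∀ w ∈ 𝔻 \ ⋃ i, pseudoDisc (z i) δ, c ≤ ‖f₁ w‖ + ‖f₂ w‖) :
    MemHInfty 2 A := by
  obtain ⟨M₁, hM₁⟩ := exists_deriv_deriv_bound hB₁
  obtain ⟨M₂, hM₂⟩ := exists_deriv_deriv_bound hB₂
  refine memHInfty_of_bound_off_pseudoDiscs hA hz hδ₀ hδ₁ hdisj (M := (M₁ + M₂) / c) fun w hw => ?_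
  rw [le_div_iff₀ hc]
  have h1 := mul_norm_coeff_le hf₁ hf₂ hw.1 (hlower w hw)
  have h2 := one_sub_normSq_pos hw.1
  calc ‖A w‖ * (1 - ‖w‖ ^ 2) ^ 2 * c = (c * ‖A w‖) * (1 - ‖w‖ ^ 2) ^ 2 := by ring
    _ ≤ (‖deriv (deriv f₁) w‖ + ‖deriv (deriv f₂) w‖) * (1 - ‖w‖ ^ 2) ^ 2 := by gcongr
    _ ≤ M₁ + M₂ := by rw [add_mul]; exact add_le_add (hM₁ w hw.1) (hM₂ w hw.1)

/-! ### Green's formula in logarithmic coordinates -/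

/-- Along lines of direction `e`, the function `u` has continuous first and second derivatives
`u₁` and `u₂` in `Ω`. -/
structure HasSecondDeriv (e : ℂ) (Ω : Set ℂ) (u u₁ u₂ : ℂ → ℝ) : Prop where
  hasDerivAt : ∀ ζ ∈ Ω, HasDerivAt (fun t : ℝ => u (ζ + t * e)) (u₁ ζ) 0
  hasDerivAt₁ : ∀ ζ ∈ Ω, HasDerivAt (fun t : ℝ => u₁ (ζ + t * e)) (u₂ ζ) 0
  cont : ContinuousOn u Ω
  cont₁ : ContinuousOn u₁ Ω
  cont₂ : ContinuousOn u₂ Ω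

/-- The open left half-plane, on which `exp` takes values in the disc. -/
def leftHalf : Set ℂ := {ζ | ζ.re < 0}

/-- The point with coordinates `p` of the plane. -/
noncomputable def planePt (p : ℝ × ℝ) : ℂ := p.1 + p.2 * Complex.I

lemma continuous_planePt : Continuous planePt := by unfold planePt; fun_prop

@[simp] lemma planePt_re (p : ℝ × ℝ) : (planePt p).re = p.1 := by simp [planePt]

@[simp] lemma planePt_im (p : ℝ × ℝ) : (planePt p).im = p.2 := by simp [planePt]

/-- `HasSecondDeriv` records derivatives at parameter `0` of lines based at each point; this moves
the base point, so that they can be integrated along a segment. -/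
lemma hasDerivAt_line {e : ℂ} {g : ℂ → ℝ} {d : ℝ} {c : ℂ} {s : ℝ}
    (h : HasDerivAt (fun t : ℝ => g (c + s * e + t * e)) d 0) :
    HasDerivAt (fun x : ℝ => g (c + x * e)) d s := by
  have h' : HasDerivAt (fun t : ℝ => g (c + s * e + t * e)) d (s - s) := by rwa [sub_self]
  refine (h'.comp_sub_const s s).congr_of_eventuallyEq (.of_forall fun x => ?_)
  simp only
  congr 1
  push_cast
  ring

/-- The rectangle `(a, b] × (0, 2π]`. -/
def periodRect (a b : ℝ) : Set (ℝ × ℝ) := Ioc a b ×ˢ Ioc 0 (2 * Real.pi)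

lemma measurableSet_periodRect (a b : ℝ) : MeasurableSet (periodRect a b) :=
  measurableSet_Ioc.prod measurableSet_Ioc

section Green

variable {u ux uxx uy uyy : ℂ → ℝ}

lemma continuousOn_rect {g : ℂ → ℝ} (hg : ContinuousOn g leftHalf) {a b : ℝ} (hb : b < 0) :
    ContinuousOn (fun p => g (planePt p)) (Icc a b ×ˢ Icc 0 (2 * Real.pi)) :=
  hg.comp continuous_planePt.continuousOn fun p hp => by
    have : p.1 ≤ b := hp.1.2
    simp only [leftHalf, mem_ofPred_eq, planePt_re]; linarith

lemma continuous_vertical {g : ℂ → ℝ} (hg : ContinuousOn g leftHalf) {b : ℝ} (hb : b < 0) :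
    Continuous (fun θ : ℝ => g (planePt (b, θ))) := by
  refine hg.comp_continuous (continuous_planePt.comp (by fun_prop)) fun θ => ?_
  simpa [leftHalf] using hb

lemma continuousOn_horizontal {g : ℂ → ℝ} (hg : ContinuousOn g leftHalf) {a b : ℝ} (hb : b < 0)
    (θ : ℝ) : ContinuousOn (fun s : ℝ => g (planePt (s, θ))) (Icc a b) := by
  refine hg.comp (continuous_planePt.comp (by fun_prop)).continuousOn fun s hs => ?_
  have := hs.2
  simp only [leftHalf, mem_ofPred_eq, planePt_re]; linarith

lemma integrableOn_periodRect {G : ℝ × ℝ → ℝ} {a b : ℝ}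
    (hG : ContinuousOn G (Icc a b ×ˢ Icc 0 (2 * Real.pi))) :
    IntegrableOn G (periodRect a b) :=
  (hG.integrableOn_compact (isCompact_Icc.prod isCompact_Icc)).mono_set
    (prod_mono Ioc_subset_Icc_self Ioc_subset_Icc_self)

lemma setIntegral_periodRect {G : ℝ × ℝ → ℝ} {a b : ℝ} (hab : a ≤ b)
    (hG : ContinuousOn G (Icc a b ×ˢ Icc 0 (2 * Real.pi))) :
    ∫ p in periodRect a b, G p = ∫ s in a..b, ∫ θ in (0 : ℝ)..2 * Real.pi, G (s, θ) := by
  have h := integrableOn_periodRect hG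
  unfold periodRect at h ⊢
  rw [Measure.volume_eq_prod] at h ⊢
  rw [setIntegral_prod _ h, intervalIntegral.integral_of_le hab]
  simp_rw [intervalIntegral.integral_of_le Real.two_pi_pos.le]

lemma setIntegral_periodRect' {G : ℝ × ℝ → ℝ} {a b : ℝ} (hab : a ≤ b)
    (hG : ContinuousOn G (Icc a b ×ˢ Icc 0 (2 * Real.pi))) :
    ∫ p in periodRect a b, G p = ∫ θ in (0 : ℝ)..2 * Real.pi, ∫ s in a..b, G (s, θ) := by
  rw [setIntegral_periodRect hab hG]
  simp_rw [intervalIntegral.integral_of_le hab, intervalIntegral.integral_of_le Real.two_pi_pos.le]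
  refine integral_integral_swap ?_
  rw [Measure.prod_restrict, ← Measure.volume_eq_prod]
  exact integrableOn_periodRect hG

/-- Green's formula on a period rectangle, with a weight `ψ` depending only on the real part. -/
theorem green_identity (hx : HasSecondDeriv 1 leftHalf u ux uxx)
    (hy : HasSecondDeriv Complex.I leftHalf u uy uyy)
    (hper : ∀ ζ, uy (ζ + 2 * Real.pi * Complex.I) = uy ζ)
    {ψ ψ₁ ψ₂ : ℝ → ℝ} (hψ : ∀ s, HasDerivAt ψ (ψ₁ s) s) (hψ₁ : ∀ s, HasDerivAt ψ₁ (ψ₂ s) s)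
    (hψ₂ : Continuous ψ₂) {a b : ℝ} (hab : a ≤ b) (hb : b < 0) :
    ∫ p in periodRect a b,
      ((uxx (planePt p) + uyy (planePt p)) * ψ p.1 - u (planePt p) * ψ₂ p.1) =
    (ψ b * ∫ θ in (0 : ℝ)..2 * Real.pi, ux (planePt (b, θ))) -
      (ψ₁ b * ∫ θ in (0 : ℝ)..2 * Real.pi, u (planePt (b, θ))) -
      ((ψ a * ∫ θ in (0 : ℝ)..2 * Real.pi, ux (planePt (a, θ))) -
      (ψ₁ a * ∫ θ in (0 : ℝ)..2 * Real.pi, u (planePt (a, θ)))) := by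
  have ha : a < 0 := hab.trans_lt hb
  have cψ : Continuous ψ := continuous_iff_continuousAt.2 fun s => (hψ s).continuousAt
  have cψ₁ : Continuous ψ₁ := continuous_iff_continuousAt.2 fun s => (hψ₁ s).continuousAt
  have cu := continuousOn_rect (a := a) hx.cont hb
  have cxx := continuousOn_rect (a := a) hx.cont₂ hb
  have cyy := continuousOn_rect (a := a) hy.cont₂ hb
  have h1 : ContinuousOn (fun p : ℝ × ℝ => uxx (planePt p) * ψ p.1 - u (planePt p) * ψ₂ p.1)
      (Icc a b ×ˢ Icc 0 (2 * Real.pi)) :=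
    (cxx.mul (cψ.comp continuous_fst).continuousOn).sub
      (cu.mul (hψ₂.comp continuous_fst).continuousOn)
  have h2 : ContinuousOn (fun p : ℝ × ℝ => uyy (planePt p) * ψ p.1)
      (Icc a b ×ˢ Icc 0 (2 * Real.pi)) := cyy.mul (cψ.comp continuous_fst).continuousOn
  have hsplit : ∀ p : ℝ × ℝ,
      (uxx (planePt p) + uyy (planePt p)) * ψ p.1 - u (planePt p) * ψ₂ p.1 =
      (uxx (planePt p) * ψ p.1 - u (planePt p) * ψ₂ p.1) + uyy (planePt p) * ψ p.1 :=
    fun p => by ring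
  simp_rw [hsplit]
  rw [integral_add (integrableOn_periodRect h1) (integrableOn_periodRect h2),
    setIntegral_periodRect' hab h1, setIntegral_periodRect hab h2]
  -- Over a full period the integral of `uyy` is the increment of the periodic function `uy`.
  have hI2 : ∫ s in a..b, ∫ θ in (0 : ℝ)..2 * Real.pi, uyy (planePt (s, θ)) * ψ s = 0 := by
    refine intervalIntegral.integral_zero_ae (.of_forall fun s hs => ?_)
    rw [uIoc_of_le hab] at hs
    have hs0 : s < 0 := hs.2.trans_lt hb
    rw [intervalIntegral.integral_mul_const,
      intervalIntegral.integral_eq_sub_of_hasDerivAt (f := fun θ => uy (planePt (s, θ)))]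
    · have := hper (planePt (s, 0))
      have h3 : planePt (s, 0) + 2 * Real.pi * Complex.I = planePt (s, 2 * Real.pi) := by
        simp [planePt]
      rw [h3] at this
      rw [this]; ring
    · intro θ _
      refine hasDerivAt_line (c := (s : ℂ)) (e := Complex.I) ?_
      exact hy.hasDerivAt₁ _ (by simpa [leftHalf] using hs0)
    · exact (continuous_vertical hy.cont₂ hs0).intervalIntegrable _ _
  -- The integrand has the antiderivative `ux ψ - u ψ'`, because the cross terms `ux ψ'` cancel.
  have hI1 : ∀ θ : ℝ, ∫ s in a..b, (uxx (planePt (s, θ)) * ψ s - u (planePt (s, θ)) * ψ₂ s) =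
      (ux (planePt (b, θ)) * ψ b - u (planePt (b, θ)) * ψ₁ b) -
      (ux (planePt (a, θ)) * ψ a - u (planePt (a, θ)) * ψ₁ a) := by
    intro θ
    have c1 := continuousOn_horizontal (a := a) hx.cont hb θ
    have c2 := continuousOn_horizontal (a := a) hx.cont₂ hb θ
    refine intervalIntegral.integral_eq_sub_of_hasDerivAt
      (f := fun s => ux (planePt (s, θ)) * ψ s - u (planePt (s, θ)) * ψ₁ s) ?_ ?_
    · intro s hs
      rw [uIcc_of_le hab] at hs
      have hs0 : s < 0 := hs.2.trans_lt hb
      have hmem : (θ * Complex.I + s * 1 : ℂ) ∈ leftHalf := by simpa [leftHalf] using hs0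
      have d1 := hasDerivAt_line (hx.hasDerivAt _ hmem)
      have d2 := hasDerivAt_line (hx.hasDerivAt₁ _ hmem)
      have e : ∀ x : ℝ, (θ * Complex.I + x * 1 : ℂ) = planePt (x, θ) := fun x => by
        simp [planePt, add_comm]
      simp only [e] at d1 d2
      exact ((d2.mul (hψ s)).sub (d1.mul (hψ₁ s))).congr_deriv (by ring)
    · refine ContinuousOn.intervalIntegrable ?_
      rw [uIcc_of_le hab]
      exact (c2.mul cψ.continuousOn).sub (c1.mul hψ₂.continuousOn)
  simp_rw [hI1]
  rw [hI2, add_zero]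
  have i1 := (continuous_vertical hx.cont hb).intervalIntegrable (μ := volume) 0 (2 * Real.pi)
  have i2 := (continuous_vertical hx.cont₁ hb).intervalIntegrable (μ := volume) 0 (2 * Real.pi)
  have i3 := (continuous_vertical hx.cont ha).intervalIntegrable (μ := volume) 0 (2 * Real.pi)
  have i4 := (continuous_vertical hx.cont₁ ha).intervalIntegrable (μ := volume) 0 (2 * Real.pi)
  rw [intervalIntegral.integral_sub ((i2.mul_const _).sub (i1.mul_const _))
      ((i4.mul_const _).sub (i3.mul_const _)),
    intervalIntegral.integral_sub (i2.mul_const _) (i1.mul_const _),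
    intervalIntegral.integral_sub (i4.mul_const _) (i3.mul_const _)]
  simp only [intervalIntegral.integral_mul_const]
  ring

/-- The circular means of a bounded subharmonic function increase. -/
lemma integral_deriv_nonneg (hx : HasSecondDeriv 1 leftHalf u ux uxx)
    (hy : HasSecondDeriv Complex.I leftHalf u uy uyy)
    (hper : ∀ ζ, uy (ζ + 2 * Real.pi * Complex.I) = uy ζ)
    (hL : ∀ ζ ∈ leftHalf, 0 ≤ uxx ζ + uyy ζ) {b C : ℝ} (hb : b < 0) (hC : 0 ≤ C)
    (hu₀ : ∀ ζ, ζ.re ≤ b → 0 ≤ u ζ) (hu : ∀ ζ, ζ.re ≤ b → u ζ ≤ C) :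
    0 ≤ ∫ θ in (0 : ℝ)..2 * Real.pi, ux (planePt (b, θ)) := by
  set N := ∫ θ in (0 : ℝ)..2 * Real.pi, ux (planePt (b, θ)) with hN
  -- The linear weight vanishing at `b - x` removes the normal derivative at the left end. Only
  -- means of `u` remain, so `N x` is bounded below independently of `x`, which forces `N ≥ 0` as
  -- `x` grows.
  have key : ∀ x : ℝ, 0 < x → -(2 * Real.pi * C) ≤ N * x := by
    intro x hx0
    have h := green_identity hx hy hper (ψ := fun s => s - (b - x)) (ψ₁ := fun _ => 1)
      (ψ₂ := fun _ => 0) (fun s => (hasDerivAt_id s).sub_const _) (fun s => hasDerivAt_const s 1)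
      continuous_const (a := b - x) (b := b) (by linarith) hb
    have h0 : 0 ≤ ∫ p in periodRect (b - x) b,
        ((uxx (planePt p) + uyy (planePt p)) * (p.1 - (b - x)) - u (planePt p) * 0) := by
      refine setIntegral_nonneg (measurableSet_periodRect _ _) fun p hp => ?_
      have hp1 := hp.1.1
      have hp2 := hp.1.2
      have := hL (planePt p) (by simp only [leftHalf, mem_ofPred_eq, planePt_re]; linarith)
      rw [mul_zero, sub_zero]
      exact mul_nonneg this (by linarith)
    rw [h] at h0
    have h1 : 0 ≤ ∫ θ in (0 : ℝ)..2 * Real.pi, u (planePt (b, θ)) :=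
      intervalIntegral.integral_nonneg Real.two_pi_pos.le fun θ _ => hu₀ _ (by simp)
    have h2 : ∫ θ in (0 : ℝ)..2 * Real.pi, u (planePt (b - x, θ)) ≤ 2 * Real.pi * C := by
      have : ∫ θ in (0 : ℝ)..2 * Real.pi, C = 2 * Real.pi * C := by simp
      rw [← this]
      refine intervalIntegral.integral_mono_on Real.two_pi_pos.le
        ((continuous_vertical hx.cont (by linarith)).intervalIntegrable _ _)
        (by simp) fun θ _ => hu _ (by simp; linarith)
    simp only [sub_self, zero_mul, one_mul, sub_sub_cancel] at h0
    nlinarith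
  by_contra hneg
  push Not at hneg
  have h3 : 0 < -N := by linarith
  have h4 : 0 ≤ 2 * Real.pi * C := by positivity
  have := key ((2 * Real.pi * C + 1) / -N) (by positivity)
  rw [show N * ((2 * Real.pi * C + 1) / -N) = -(2 * Real.pi * C + 1) by
    rw [div_neg, mul_neg, mul_div_cancel₀ _ hneg.ne]] at this
  linarith

/-- All terms at the left end have a favourable sign: the mean of `ux` is nonnegative by
`integral_deriv_nonneg`, and `u ≥ 0`, `ψ ≥ 0`, `ψ' ≤ 0`. The resulting bound is uniform in `a`, so
the annuli can exhaust the punctured disc. -/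
theorem green_le (hx : HasSecondDeriv 1 leftHalf u ux uxx)
    (hy : HasSecondDeriv Complex.I leftHalf u uy uyy)
    (hper : ∀ ζ, uy (ζ + 2 * Real.pi * Complex.I) = uy ζ)
    (hL : ∀ ζ ∈ leftHalf, 0 ≤ uxx ζ + uyy ζ) {b C : ℝ} (hb : b < 0) (hC : 0 ≤ C)
    (hu₀ : ∀ ζ, ζ.re ≤ b → 0 ≤ u ζ) (hu : ∀ ζ, ζ.re ≤ b → u ζ ≤ C)
    {ψ ψ₁ ψ₂ : ℝ → ℝ} (hψ : ∀ s, HasDerivAt ψ (ψ₁ s) s) (hψ₁ : ∀ s, HasDerivAt ψ₁ (ψ₂ s) s)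
    (hψ₂ : Continuous ψ₂) (hψb : ψ b = 0) (hψ0 : ∀ s ≤ b, 0 ≤ ψ s) (hψ₁0 : ∀ s ≤ b, ψ₁ s ≤ 0)
    {a : ℝ} (hab : a ≤ b) :
    ∫ p in periodRect a b,
      ((uxx (planePt p) + uyy (planePt p)) * ψ p.1 - u (planePt p) * ψ₂ p.1) ≤
    -ψ₁ b * ∫ θ in (0 : ℝ)..2 * Real.pi, u (planePt (b, θ)) := by
  rw [green_identity hx hy hper hψ hψ₁ hψ₂ hab hb, hψb]
  have h1 := integral_deriv_nonneg hx hy hper hL (b := a) (C := C) (hab.trans_lt hb) hC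
    (fun ζ h => hu₀ ζ (h.trans hab)) (fun ζ h => hu ζ (h.trans hab))
  have h2 : 0 ≤ ∫ θ in (0 : ℝ)..2 * Real.pi, u (planePt (a, θ)) :=
    intervalIntegral.integral_nonneg Real.two_pi_pos.le fun θ _ => hu₀ _ (by simpa using hab)
  have h3 := mul_nonneg (hψ0 a hab) h1
  have h4 := mul_nonneg_of_nonpos_of_nonpos (hψ₁0 a hab) (neg_nonpos.2 h2)
  linarith

end Green

/-! ### Area integrals in logarithmic polar coordinates -/

/-- The real determinant of a complex linear map is the norm from `ℂ` to `ℝ` of its complex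
determinant. -/
lemma abs_det_restrictScalars_smulRight (c : ℂ) :
    |((ContinuousLinearMap.toSpanSingleton ℂ c).restrictScalars ℝ).det| = ‖c‖ ^ 2 := by
  have h : (((ContinuousLinearMap.toSpanSingleton ℂ c).restrictScalars ℝ : ℂ →L[ℝ] ℂ) : ℂ →ₗ[ℝ] ℂ)
      = (LinearMap.toSpanSingleton ℂ ℂ c).restrictScalars ℝ := rfl
  rw [ContinuousLinearMap.det, h, LinearMap.det_restrictScalars]
  simp [Algebra.norm_complex_apply, Complex.normSq_eq_norm_sq]

/-- Change of variables under an injective holomorphic map. -/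
lemma lintegral_image_holomorphic {φ φ' : ℂ → ℂ} {S : Set ℂ} (hS : MeasurableSet S)
    (hφ : ∀ z ∈ S, HasDerivAt φ (φ' z) z) (hinj : InjOn φ S) (g : ℂ → ℝ≥0∞) :
    ∫⁻ z in φ '' S, g z = ∫⁻ z in S, ENNReal.ofReal (‖φ' z‖ ^ 2) * g (φ z) := by
  rw [lintegral_image_eq_lintegral_abs_det_fderiv_mul volume hS
    (f' := fun z => (ContinuousLinearMap.toSpanSingleton ℂ (φ' z)).restrictScalars ℝ)
    (fun z hz => ((hφ z hz).hasFDerivAt.restrictScalars ℝ).hasFDerivWithinAt) hinj]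
  simp_rw [abs_det_restrictScalars_smulRight]

lemma exp_image_strip (a b : ℝ) :
    Complex.exp '' {ζ | ζ.re ∈ Ioc a b ∧ ζ.im ∈ Ioc 0 (2 * Real.pi)} =
      {z | Real.exp a < ‖z‖ ∧ ‖z‖ ≤ Real.exp b} := by
  ext z
  constructor
  · rintro ⟨ζ, ⟨h1, -⟩, rfl⟩
    simp only [mem_ofPred_eq, Complex.norm_exp, Real.exp_lt_exp, Real.exp_le_exp]
    exact h1
  · rintro ⟨h1, h2⟩
    have hz : 0 < ‖z‖ := (Real.exp_pos a).trans h1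
    -- The branch `log (-z) + π i` has imaginary part in `(0, 2π]`, matching the strip.
    have hz0 : -z ≠ 0 := neg_ne_zero.2 (norm_pos_iff.1 hz)
    refine ⟨Complex.log (-z) + Real.pi * Complex.I, ⟨?_, ?_⟩, ?_⟩
    · simp only [Complex.add_re, Complex.log_re, norm_neg, Complex.mul_re, Complex.ofReal_re,
        Complex.I_re, mul_zero, Complex.ofReal_im, Complex.I_im, mul_one, sub_self, add_zero]
      exact ⟨(Real.lt_log_iff_exp_lt hz).2 h1, (Real.log_le_iff_le_exp hz).2 h2⟩
    · simp only [Complex.add_im, Complex.log_im, Complex.mul_im, Complex.ofReal_re, Complex.I_im,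
        mul_one, Complex.ofReal_im, Complex.I_re, mul_zero, add_zero]
      have := Complex.neg_pi_lt_arg (-z)
      have := Complex.arg_le_pi (-z)
      constructor <;> linarith
    · rw [Complex.exp_add, Complex.exp_log hz0, Complex.exp_pi_mul_I]; ring

lemma exp_injOn_strip : InjOn Complex.exp {ζ : ℂ | ζ.im ∈ Ioc 0 (2 * Real.pi)} := by
  intro x hx y hy hxy
  have h : ∀ ζ : ℂ, ζ.im ∈ Ioc 0 (2 * Real.pi) →
      Complex.log (-Complex.exp ζ) + Real.pi * Complex.I = ζ := by
    intro ζ hζ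
    have : -Complex.exp ζ = Complex.exp (ζ - Real.pi * Complex.I) := by
      rw [Complex.exp_sub, Complex.exp_pi_mul_I]; ring
    rw [this, Complex.log_exp]
    · ring
    · simp only [Complex.sub_im, Complex.mul_im, Complex.ofReal_re, Complex.I_im, mul_one,
        Complex.ofReal_im, Complex.I_re, mul_zero, add_zero]
      linarith [hζ.1]
    · simp only [Complex.sub_im, Complex.mul_im, Complex.ofReal_re, Complex.I_im, mul_one,
        Complex.ofReal_im, Complex.I_re, mul_zero, add_zero]
      linarith [hζ.2]
  rw [← h x hx, ← h y hy, hxy]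

/-- Integration over an annulus in logarithmic polar coordinates. -/
lemma lintegral_annulus (a b : ℝ) (g : ℂ → ℝ≥0∞) :
    ∫⁻ z in {z | Real.exp a < ‖z‖ ∧ ‖z‖ ≤ Real.exp b}, g z =
      ∫⁻ p in periodRect a b, ENNReal.ofReal (Real.exp (2 * p.1)) * g (Complex.exp (planePt p)) := by
  have hS : MeasurableSet {ζ : ℂ | ζ.re ∈ Ioc a b ∧ ζ.im ∈ Ioc 0 (2 * Real.pi)} :=
    (Complex.measurable_re measurableSet_Ioc).inter (Complex.measurable_im measurableSet_Ioc)
  rw [← exp_image_strip, lintegral_image_holomorphic hS (φ' := Complex.exp)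
    (fun z _ => Complex.hasDerivAt_exp z) (exp_injOn_strip.mono fun ζ h => h.2)]
  have h := (Complex.volume_preserving_equiv_real_prod.symm).setLIntegral_comp_preimage_emb
    Complex.measurableEquivRealProd.symm.measurableEmbedding
    (fun z => ENNReal.ofReal (‖Complex.exp z‖ ^ 2) * g (Complex.exp z))
    {ζ : ℂ | ζ.re ∈ Ioc a b ∧ ζ.im ∈ Ioc 0 (2 * Real.pi)}
  have he : ∀ p, Complex.measurableEquivRealProd.symm p = planePt p := fun p => by
    apply Complex.ext <;> simp [Complex.measurableEquivRealProd_symm_apply]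
  have hpre : Complex.measurableEquivRealProd.symm ⁻¹'
      {ζ : ℂ | ζ.re ∈ Ioc a b ∧ ζ.im ∈ Ioc 0 (2 * Real.pi)} = periodRect a b := by
    ext p
    simp only [mem_preimage, he, mem_ofPred_eq, planePt_re, planePt_im, periodRect, mem_prod]
  rw [hpre] at h
  rw [← h]
  refine lintegral_congr fun p => ?_
  rw [he, Complex.norm_exp, planePt_re, ← Real.exp_nat_mul]
  norm_num

/-- The exponential omits the origin, but that point is null and the annuli increase to the
punctured disc. -/
lemma lintegral_closedBall_le_of_annulus {g : ℂ → ℝ≥0∞} {B : ℝ≥0∞} {b : ℝ}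
    (h : ∀ a ≤ b, ∫⁻ z in {z | Real.exp a < ‖z‖ ∧ ‖z‖ ≤ Real.exp b}, g z ≤ B) :
    ∫⁻ z in closedBall (0 : ℂ) (Real.exp b), g z ≤ B := by
  set S : ℕ → Set ℂ := fun n => {z | Real.exp (b - n) < ‖z‖ ∧ ‖z‖ ≤ Real.exp b} with hS
  have hU : closedBall (0 : ℂ) (Real.exp b) =ᵐ[volume] ⋃ n, S n := by
    have h0 : ∀ᵐ z : ℂ, z ≠ 0 := Measure.ae_ne volume 0
    filter_upwards [h0] with z hz
    refine propext ?_
    change z ∈ closedBall (0 : ℂ) (Real.exp b) ↔ z ∈ ⋃ n, S n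
    rw [mem_closedBall_zero_iff, mem_iUnion]
    constructor
    · intro hz1
      have hz' : 0 < ‖z‖ := norm_pos_iff.2 hz
      obtain ⟨n, hn⟩ := exists_nat_gt (b - Real.log ‖z‖)
      refine ⟨n, ?_, hz1⟩
      rw [← Real.lt_log_iff_exp_lt hz']
      linarith
    · rintro ⟨n, -, h2⟩
      exact h2
  have hdir : Directed (· ⊆ ·) S := by
    refine Monotone.directed_le fun m n hmn z hz => ⟨lt_of_le_of_lt ?_ hz.1, hz.2⟩
    rw [Real.exp_le_exp]
    have : (m : ℝ) ≤ n := by exact_mod_cast hmn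
    linarith
  rw [setLIntegral_congr hU, setLIntegral_iUnion_of_directed g hdir]
  exact iSup_le fun n => h _ (by linarith [n.cast_nonneg (α := ℝ)])

/-- Passage from weighted integrals over period rectangles to an area integral over the disc. -/
lemma lintegral_disc_le {Φ : ℂ → ℝ} (hΦ : ContinuousOn Φ 𝔻) (hΦ0 : ∀ z ∈ 𝔻, 0 ≤ Φ z) (k : ℕ)
    {B : ℝ≥0∞} (h : ∀ b < 0, ∀ a ≤ b, ENNReal.ofReal (∫ p in periodRect a b,
      Real.exp (2 * p.1) * Φ (Complex.exp (planePt p)) *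
        (Real.exp (2 * b) - Real.exp (2 * p.1)) ^ k) ≤ B) :
    ∫⁻ z in 𝔻, ENNReal.ofReal (Φ z * (1 - ‖z‖ ^ 2) ^ k) ≤ 2 ^ k * B := by
  have hexp : ∀ t : ℝ, Real.exp t ^ 2 = Real.exp (2 * t) := fun t => by
    rw [← Real.exp_nat_mul]; norm_num
  have key : ∀ b < 0, ∫⁻ z in closedBall (0 : ℂ) (Real.exp b),
      ENNReal.ofReal (Φ z * (Real.exp b ^ 2 - ‖z‖ ^ 2) ^ k) ≤ B := by
    intro b hb
    refine lintegral_closedBall_le_of_annulus fun a hab => ?_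
    rw [lintegral_annulus]
    refine le_trans (le_of_eq ?_) (h b hb a hab)
    rw [ofReal_integral_eq_lintegral_ofReal]
    · refine lintegral_congr fun p => ?_
      rw [← ENNReal.ofReal_mul (Real.exp_pos _).le, Complex.norm_exp, planePt_re, hexp, hexp]
      ring_nf
    · refine integrableOn_periodRect ?_
      refine ContinuousOn.mul (ContinuousOn.mul (by fun_prop) ?_) (by fun_prop)
      refine hΦ.comp (Complex.continuous_exp.comp continuous_planePt).continuousOn fun p hp => ?_
      have : p.1 ≤ b := hp.1.2
      rw [mem_disc_iff, Complex.norm_exp, planePt_re, Real.exp_lt_one_iff]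
      linarith
    · refine (ae_restrict_iff' (measurableSet_periodRect a b)).2 (.of_forall fun p hp => ?_)
      have h1 : p.1 ≤ b := hp.1.2
      have h2 : Complex.exp (planePt p) ∈ 𝔻 := by
        rw [mem_disc_iff, Complex.norm_exp, planePt_re, Real.exp_lt_one_iff]
        linarith
      have h3 : Real.exp (2 * p.1) ≤ Real.exp (2 * b) := Real.exp_le_exp.2 (by linarith)
      exact mul_nonneg (mul_nonneg (Real.exp_pos _).le (hΦ0 _ h2)) (pow_nonneg (by linarith) _)
  have key2 : ∀ n : ℕ, ∫⁻ z in ball (0 : ℂ) (1 - 1 / (n + 1)),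
      ENNReal.ofReal (Φ z * (1 - ‖z‖ ^ 2) ^ k) ≤ 2 ^ k * B := by
    intro n
    set ρ : ℝ := 1 - 1 / (n + 1) with hρ
    have hn : (0 : ℝ) < 1 / (n + 1) := by positivity
    have hn1 : (1 : ℝ) / (n + 1) ≤ 1 := by
      rw [div_le_one (by positivity)]; linarith [n.cast_nonneg (α := ℝ)]
    have hρ1 : ρ < 1 := by linarith
    have hρ0 : 0 ≤ ρ := by linarith
    -- With `R² = (1 + ρ²) / 2`, one has `1 - |z|² ≤ 2 (R² - |z|²)` for `|z| < ρ`. This is the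
    -- origin of the factor `2 ^ k`.
    set R : ℝ := Real.sqrt ((1 + ρ ^ 2) / 2) with hR
    have hR2 : R ^ 2 = (1 + ρ ^ 2) / 2 := Real.sq_sqrt (by positivity)
    have hR0 : 0 < R := Real.sqrt_pos.2 (by positivity)
    have hR1 : R < 1 := by nlinarith
    have hρR : ρ < R := by nlinarith
    have hk := key (Real.log R) (Real.log_neg hR0 hR1)
    rw [Real.exp_log hR0] at hk
    calc ∫⁻ z in ball (0 : ℂ) ρ, ENNReal.ofReal (Φ z * (1 - ‖z‖ ^ 2) ^ k)
        ≤ ∫⁻ z in ball (0 : ℂ) ρ, 2 ^ k * ENNReal.ofReal (Φ z * (R ^ 2 - ‖z‖ ^ 2) ^ k) := by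
          refine setLIntegral_mono' measurableSet_ball fun z hz => ?_
          rw [mem_ball_zero_iff] at hz
          have h2 : (2 : ℝ≥0∞) ^ k = ENNReal.ofReal (2 ^ k) := by
            rw [ENNReal.ofReal_pow (by norm_num)]; norm_num
          rw [h2, ← ENNReal.ofReal_mul (by positivity)]
          apply ENNReal.ofReal_le_ofReal
          have hzD : z ∈ 𝔻 := mem_disc_iff.2 (by linarith)
          have h3 : 1 - ‖z‖ ^ 2 ≤ 2 * (R ^ 2 - ‖z‖ ^ 2) := by
            nlinarith [norm_nonneg z]
          have h4 := one_sub_normSq_pos hzD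
          calc Φ z * (1 - ‖z‖ ^ 2) ^ k ≤ Φ z * (2 * (R ^ 2 - ‖z‖ ^ 2)) ^ k := by
                have := hΦ0 z hzD
                gcongr
            _ = _ := by rw [mul_pow]; ring
      _ = 2 ^ k * ∫⁻ z in ball (0 : ℂ) ρ, ENNReal.ofReal (Φ z * (R ^ 2 - ‖z‖ ^ 2) ^ k) := by
          rw [lintegral_const_mul' _ _ (by simp)]
      _ ≤ 2 ^ k * ∫⁻ z in closedBall (0 : ℂ) R, ENNReal.ofReal (Φ z * (R ^ 2 - ‖z‖ ^ 2) ^ k) := by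
          gcongr
          exact (ball_subset_ball hρR.le).trans ball_subset_closedBall
      _ ≤ 2 ^ k * B := by gcongr
  have hU : (𝔻 : Set ℂ) = ⋃ n : ℕ, ball (0 : ℂ) (1 - 1 / (n + 1)) := by
    ext z
    rw [mem_disc_iff, mem_iUnion]
    constructor
    · intro hz
      obtain ⟨n, hn⟩ := exists_nat_one_div_lt (sub_pos.2 hz)
      exact ⟨n, by rw [mem_ball_zero_iff]; linarith⟩
    · rintro ⟨n, hn⟩
      rw [mem_ball_zero_iff] at hn
      have : (0 : ℝ) < 1 / (n + 1) := by positivity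
      linarith
  have hdir : Directed (· ⊆ ·) fun n : ℕ => ball (0 : ℂ) (1 - 1 / (n + 1)) := by
    refine Monotone.directed_le fun m n hmn => ball_subset_ball ?_
    have : (m : ℝ) ≤ n := by exact_mod_cast hmn
    gcongr
  rw [hU, setLIntegral_iUnion_of_directed _ hdir]
  exact iSup_le key2

/-- The circular integral in logarithmic coordinates, compared with the Hardy norm. -/
lemma ofReal_integral_circle_le {f : ℂ → ℂ} (hf : IsAnalytic f) {p : ℝ} (hp : 0 < p) {b : ℝ}
    (hb : b < 0) :
    ENNReal.ofReal (∫ θ in (0 : ℝ)..2 * Real.pi, ‖f (Complex.exp (planePt (b, θ)))‖ ^ p) ≤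
      ENNReal.ofReal (2 * Real.pi) * hardyNormPow p f := by
  have hmem : ∀ θ : ℝ, Complex.exp (planePt (b, θ)) ∈ 𝔻 := fun θ => by
    rw [mem_disc_iff, Complex.norm_exp, planePt_re, Real.exp_lt_one_iff]; exact hb
  have hcont : Continuous fun θ : ℝ => ‖f (Complex.exp (planePt (b, θ)))‖ ^ p := by
    refine Continuous.rpow_const ?_ fun _ => Or.inr hp.le
    refine continuous_norm.comp (hf.continuousOn.comp_continuous ?_ hmem)
    exact Complex.continuous_exp.comp (continuous_planePt.comp (by fun_prop))
  have h1 : integralMean p f (Real.exp b) ≤ hardyNormPow p f :=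
    le_iSup₂_of_le (f := fun r (_ : r ∈ Ico (0 : ℝ) 1) => integralMean p f r) (Real.exp b)
      ⟨(Real.exp_pos b).le, Real.exp_lt_one_iff.2 hb⟩ le_rfl
  refine le_trans (le_of_eq ?_) (mul_le_mul_right h1 _)
  rw [integralMean, ← mul_assoc, ENNReal.mul_inv_cancel, one_mul,
    intervalIntegral.integral_of_le Real.two_pi_pos.le, ofReal_integral_eq_lintegral_ofReal]
  · rw [restrict_Ioc_eq_restrict_Icc]
    refine lintegral_congr fun θ => ?_
    rw [← ENNReal.ofReal_rpow_of_nonneg (norm_nonneg _) hp.le, ofReal_norm]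
    congr 3
    simp [circleMap, planePt, Complex.exp_add]
  · exact (hcont.integrableOn_Icc).mono_set Ioc_subset_Icc_self
  · exact .of_forall fun θ => by positivity
  · simp [Real.pi_pos]
  · exact ENNReal.ofReal_ne_top

/-! ### Calculus of directional second derivatives -/

section SecondDeriv

variable {e : ℂ} {Ω : Set ℂ}

lemma hasDerivAt_comp_line {F : ℂ → ℂ} {d ζ : ℂ} (h : HasDerivAt F d ζ) :
    HasDerivAt (fun t : ℝ => F (ζ + t * e)) (d * e) 0 := by
  have h1 : HasDerivAt (fun t : ℂ => ζ + t * e) e ((0 : ℝ) : ℂ) := by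
    simpa using ((hasDerivAt_id ((0 : ℝ) : ℂ)).mul_const e).const_add ζ
  have h2 : HasDerivAt F d (ζ + ((0 : ℝ) : ℂ) * e) := by simpa using h
  exact (HasDerivAt.comp (h₂ := F) ((0 : ℝ) : ℂ) h2 h1).comp_ofReal

lemma hasSecondDeriv_normSq {F F' F'' : ℂ → ℂ} (h : ∀ ζ ∈ Ω, HasDerivAt F (F' ζ) ζ)
    (h' : ∀ ζ ∈ Ω, HasDerivAt F' (F'' ζ) ζ) (hc : ContinuousOn F'' Ω) :
    HasSecondDeriv e Ω (fun ζ => ‖F ζ‖ ^ 2) (fun ζ => 2 * inner ℝ (F ζ) (F' ζ * e))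
      (fun ζ => 2 * (inner ℝ (F ζ) (F'' ζ * e * e) + inner ℝ (F' ζ * e) (F' ζ * e))) := by
  have c0 : ContinuousOn F Ω := fun ζ hζ => (h ζ hζ).continuousAt.continuousWithinAt
  have c1 : ContinuousOn F' Ω := fun ζ hζ => (h' ζ hζ).continuousAt.continuousWithinAt
  refine ⟨fun ζ hζ => ?_, fun ζ hζ => ?_, by fun_prop, ?_, ?_⟩
  · simpa using (hasDerivAt_comp_line (e := e) (h ζ hζ)).norm_sq
  · have h1 := hasDerivAt_comp_line (e := e) (h ζ hζ)
    have h2 := (hasDerivAt_comp_line (e := e) (h' ζ hζ)).mul_const e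
    simpa using (h1.inner ℝ h2).const_mul 2
  · exact continuousOn_const.mul (c0.inner (𝕜 := ℝ) (c1.mul continuousOn_const))
  · exact continuousOn_const.mul ((c0.inner (𝕜 := ℝ) ((hc.mul continuousOn_const).mul
      continuousOn_const)).add ((c1.mul continuousOn_const).inner (𝕜 := ℝ)
        (c1.mul continuousOn_const)))

variable {u u₁ u₂ v v₁ v₂ : ℂ → ℝ}

lemma HasSecondDeriv.add (hu : HasSecondDeriv e Ω u u₁ u₂) (hv : HasSecondDeriv e Ω v v₁ v₂) :
    HasSecondDeriv e Ω (fun ζ => u ζ + v ζ) (fun ζ => u₁ ζ + v₁ ζ) (fun ζ => u₂ ζ + v₂ ζ) :=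
  ⟨fun ζ hζ => (hu.1 ζ hζ).add (hv.1 ζ hζ), fun ζ hζ => (hu.2 ζ hζ).add (hv.2 ζ hζ),
    hu.3.add hv.3, hu.4.add hv.4, hu.5.add hv.5⟩

lemma HasSecondDeriv.const_mul (hu : HasSecondDeriv e Ω u u₁ u₂) (c : ℝ) :
    HasSecondDeriv e Ω (fun ζ => c * u ζ) (fun ζ => c * u₁ ζ) (fun ζ => c * u₂ ζ) :=
  ⟨fun ζ hζ => (hu.1 ζ hζ).const_mul c, fun ζ hζ => (hu.2 ζ hζ).const_mul c,
    continuousOn_const.mul hu.3, continuousOn_const.mul hu.4, continuousOn_const.mul hu.5⟩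

lemma HasSecondDeriv.sub (hu : HasSecondDeriv e Ω u u₁ u₂) (hv : HasSecondDeriv e Ω v v₁ v₂) :
    HasSecondDeriv e Ω (fun ζ => u ζ - v ζ) (fun ζ => u₁ ζ - v₁ ζ) (fun ζ => u₂ ζ - v₂ ζ) :=
  ⟨fun ζ hζ => (hu.1 ζ hζ).sub (hv.1 ζ hζ), fun ζ hζ => (hu.2 ζ hζ).sub (hv.2 ζ hζ),
    hu.3.sub hv.3, hu.4.sub hv.4, hu.5.sub hv.5⟩

lemma HasSecondDeriv.add_const (hu : HasSecondDeriv e Ω u u₁ u₂) (c : ℝ) :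
    HasSecondDeriv e Ω (fun ζ => u ζ + c) u₁ u₂ :=
  ⟨fun ζ hζ => (hu.1 ζ hζ).add_const c, hu.2, hu.3.add continuousOn_const, hu.4, hu.5⟩

lemma HasSecondDeriv.sum {ι : Type*} (s : Finset ι) {w w₁ w₂ : ι → ℂ → ℝ}
    (h : ∀ i ∈ s, HasSecondDeriv e Ω (w i) (w₁ i) (w₂ i)) :
    HasSecondDeriv e Ω (fun ζ => ∑ i ∈ s, w i ζ) (fun ζ => ∑ i ∈ s, w₁ i ζ)
      (fun ζ => ∑ i ∈ s, w₂ i ζ) :=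
  ⟨fun ζ hζ => HasDerivAt.fun_sum fun i hi => (h i hi).1 ζ hζ,
    fun ζ hζ => HasDerivAt.fun_sum fun i hi => (h i hi).2 ζ hζ,
    continuousOn_finsetSum s fun i hi => (h i hi).3,
    continuousOn_finsetSum s fun i hi => (h i hi).4,
    continuousOn_finsetSum s fun i hi => (h i hi).5⟩

lemma HasSecondDeriv.exp (hu : HasSecondDeriv e Ω u u₁ u₂) :
    HasSecondDeriv e Ω (fun ζ => Real.exp (u ζ)) (fun ζ => Real.exp (u ζ) * u₁ ζ)
      (fun ζ => Real.exp (u ζ) * (u₂ ζ + u₁ ζ ^ 2)) := by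
  have c0 := hu.3
  have c1 := hu.4
  have c2 := hu.5
  refine ⟨fun ζ hζ => ?_, fun ζ hζ => ?_, c0.rexp, c0.rexp.mul c1, c0.rexp.mul (c2.add (c1.pow 2))⟩
  · simpa using (hu.1 ζ hζ).exp
  · refine ((hu.1 ζ hζ).exp.mul (hu.2 ζ hζ)).congr_deriv ?_
    simp only [Complex.ofReal_zero, zero_mul, add_zero]
    ring

lemma HasSecondDeriv.log (hu : HasSecondDeriv e Ω u u₁ u₂) (h0 : ∀ ζ ∈ Ω, 0 < u ζ) :
    HasSecondDeriv e Ω (fun ζ => Real.log (u ζ)) (fun ζ => u₁ ζ / u ζ)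
      (fun ζ => (u₂ ζ * u ζ - u₁ ζ * u₁ ζ) / u ζ ^ 2) := by
  have c0 := hu.3
  have c1 := hu.4
  have c2 := hu.5
  have hne : ∀ ζ ∈ Ω, u ζ ≠ 0 := fun ζ hζ => (h0 ζ hζ).ne'
  refine ⟨fun ζ hζ => ?_, fun ζ hζ => ?_, c0.log hne, c1.div c0 hne,
    ((c2.mul c0).sub (c1.mul c1)).div (c0.pow 2) fun ζ hζ => pow_ne_zero 2 (hne ζ hζ)⟩
  · simpa using (hu.1 ζ hζ).log (by simpa using hne ζ hζ)
  · refine ((hu.2 ζ hζ).fun_div (hu.1 ζ hζ) (by simpa using hne ζ hζ)).congr_deriv ?_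
    simp

/-- The Laplacian of `|F|²` is `4 |F'|²`. -/
lemma laplacian_normSq (F F' F'' : ℂ) :
    2 * (inner ℝ F (F'' * 1 * 1) + inner ℝ (F' * 1) (F' * 1)) +
      2 * (inner ℝ F (F'' * Complex.I * Complex.I) + inner ℝ (F' * Complex.I) (F' * Complex.I)) =
      4 * ‖F'‖ ^ 2 := by
  have : F'' * Complex.I * Complex.I = -F'' := by rw [mul_assoc, Complex.I_mul_I]; ring
  rw [this, inner_neg_right, mul_one, mul_one, mul_one, real_inner_self_eq_norm_sq,
    real_inner_self_eq_norm_sq, norm_mul, Complex.norm_I]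
  ring

/-- The two terms are the squared real and imaginary parts of `2 conj F * F'`. Together with
`laplacian_normSq` this gives `|∇|F|²|² = |F|² Δ|F|²`, which makes the Laplacian of `log (|F|² + ε)`
explicit. -/
lemma gradient_normSq (F F' : ℂ) :
    (2 * inner ℝ F (F' * 1)) ^ 2 + (2 * inner ℝ F (F' * Complex.I)) ^ 2 =
      4 * (‖F‖ ^ 2 * ‖F'‖ ^ 2) := by
  simp only [Complex.inner, Complex.sq_norm, Complex.normSq_apply, Complex.mul_re, Complex.mul_im,
    Complex.conj_re, Complex.conj_im, Complex.I_re, Complex.I_im, Complex.one_re, Complex.one_im]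
  ring

end SecondDeriv

/-! ### Pullbacks by the exponential -/

lemma exp_mem_disc {ζ : ℂ} (hζ : ζ ∈ leftHalf) : Complex.exp ζ ∈ 𝔻 := by
  rw [mem_disc_iff, Complex.norm_exp, Real.exp_lt_one_iff]; exact hζ

lemma isAnalytic_deriv {f : ℂ → ℂ} (hf : IsAnalytic f) : IsAnalytic (deriv f) :=
  AnalyticOnNhd.deriv hf

lemma hasDerivAt_comp_exp {f : ℂ → ℂ} (hf : IsAnalytic f) {ζ : ℂ} (hζ : ζ ∈ leftHalf) :
    HasDerivAt (fun ζ => f (Complex.exp ζ)) (deriv f (Complex.exp ζ) * Complex.exp ζ) ζ :=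
  (hf _ (exp_mem_disc hζ)).differentiableAt.hasDerivAt.comp ζ (Complex.hasDerivAt_exp ζ)

lemma hasDerivAt_comp_exp₂ {f : ℂ → ℂ} (hf : IsAnalytic f) {ζ : ℂ} (hζ : ζ ∈ leftHalf) :
    HasDerivAt (fun ζ => deriv f (Complex.exp ζ) * Complex.exp ζ)
      (deriv (deriv f) (Complex.exp ζ) * Complex.exp ζ * Complex.exp ζ +
        deriv f (Complex.exp ζ) * Complex.exp ζ) ζ :=
  (hasDerivAt_comp_exp (isAnalytic_deriv hf) hζ).mul (Complex.hasDerivAt_exp ζ)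

lemma continuousOn_comp_exp {f : ℂ → ℂ} (hf : IsAnalytic f) :
    ContinuousOn (fun ζ => f (Complex.exp ζ)) leftHalf :=
  hf.continuousOn.comp Complex.continuous_exp.continuousOn fun _ => exp_mem_disc

/-- First derivative of `|f ∘ exp|²` in the direction `e`. -/
noncomputable def sqExp₁ (f : ℂ → ℂ) (e ζ : ℂ) : ℝ :=
  2 * inner ℝ (f (Complex.exp ζ)) (deriv f (Complex.exp ζ) * Complex.exp ζ * e)

/-- Second derivative of `|f ∘ exp|²` in the direction `e`. -/
noncomputable def sqExp₂ (f : ℂ → ℂ) (e ζ : ℂ) : ℝ :=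
  2 * (inner ℝ (f (Complex.exp ζ)) ((deriv (deriv f) (Complex.exp ζ) * Complex.exp ζ *
      Complex.exp ζ + deriv f (Complex.exp ζ) * Complex.exp ζ) * e * e) +
    inner ℝ (deriv f (Complex.exp ζ) * Complex.exp ζ * e)
      (deriv f (Complex.exp ζ) * Complex.exp ζ * e))

lemma hasSecondDeriv_sqExp {f : ℂ → ℂ} (hf : IsAnalytic f) (e : ℂ) :
    HasSecondDeriv e leftHalf (fun ζ => ‖f (Complex.exp ζ)‖ ^ 2) (sqExp₁ f e) (sqExp₂ f e) := by
  refine hasSecondDeriv_normSq (fun ζ hζ => hasDerivAt_comp_exp hf hζ)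
    (fun ζ hζ => hasDerivAt_comp_exp₂ hf hζ) ?_
  have c1 := continuousOn_comp_exp (isAnalytic_deriv hf)
  have c2 := continuousOn_comp_exp (isAnalytic_deriv (isAnalytic_deriv hf))
  have ce := Complex.continuous_exp.continuousOn (s := leftHalf)
  exact ((c2.mul ce).mul ce).add (c1.mul ce)

lemma sqExp₂_add (f : ℂ → ℂ) (ζ : ℂ) : sqExp₂ f 1 ζ + sqExp₂ f Complex.I ζ =
    4 * (Real.exp (2 * ζ.re) * ‖deriv f (Complex.exp ζ)‖ ^ 2) := by
  have h : Real.exp (2 * ζ.re) = Real.exp ζ.re ^ 2 := by rw [← Real.exp_nat_mul]; norm_num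
  rw [sqExp₂, sqExp₂, laplacian_normSq, norm_mul, Complex.norm_exp, h]
  ring

lemma sqExp₁_sq_add (f : ℂ → ℂ) (ζ : ℂ) : sqExp₁ f 1 ζ ^ 2 + sqExp₁ f Complex.I ζ ^ 2 =
    ‖f (Complex.exp ζ)‖ ^ 2 * (sqExp₂ f 1 ζ + sqExp₂ f Complex.I ζ) := by
  rw [sqExp₂, sqExp₂, laplacian_normSq, sqExp₁, sqExp₁, gradient_normSq]
  ring

lemma sqExp₁_periodic (f : ℂ → ℂ) (e ζ : ℂ) :
    sqExp₁ f e (ζ + 2 * Real.pi * Complex.I) = sqExp₁ f e ζ := by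
  simp only [sqExp₁, Complex.exp_periodic ζ]

/-- A left half-plane `Re ζ ≤ b` maps into a compact disc. This supplies the upper bound required by
`integral_deriv_nonneg`. -/
lemma exists_bound_comp_exp {f : ℂ → ℂ} (hf : IsAnalytic f) {b : ℝ} (hb : b < 0) :
    ∃ C, 0 ≤ C ∧ ∀ ζ : ℂ, ζ.re ≤ b → ‖f (Complex.exp ζ)‖ ≤ C := by
  have hsub : closedBall (0 : ℂ) (Real.exp b) ⊆ 𝔻 :=
    closedBall_subset_ball (Real.exp_lt_one_iff.2 hb)
  obtain ⟨C, hC⟩ := (isCompact_closedBall (0 : ℂ) (Real.exp b)).exists_bound_of_continuousOn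
    (hf.continuousOn.mono hsub)
  have h : ∀ ζ : ℂ, ζ.re ≤ b → ‖f (Complex.exp ζ)‖ ≤ C := fun ζ hζ => hC _ <| by
    rw [mem_closedBall_zero_iff, Complex.norm_exp]; exact Real.exp_le_exp.2 hζ
  exact ⟨C, (norm_nonneg _).trans (h b (by simp)), h⟩

/-! ### Weighted integrals of the Laplacian -/

lemma hasDerivAt_exp_two_mul (s : ℝ) :
    HasDerivAt (fun s : ℝ => Real.exp (2 * s)) (2 * Real.exp (2 * s)) s := by
  have := ((hasDerivAt_id s).const_mul (2 : ℝ)).exp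
  simpa [mul_comm] using this

lemma hasDerivAt_weight (b s : ℝ) :
    HasDerivAt (fun s : ℝ => Real.exp (2 * b) - Real.exp (2 * s)) (-(2 * Real.exp (2 * s))) s :=
  (hasDerivAt_exp_two_mul s).const_sub _

lemma hasDerivAt_weight₁ (s : ℝ) :
    HasDerivAt (fun s : ℝ => -(2 * Real.exp (2 * s))) (-(4 * Real.exp (2 * s))) s :=
  ((hasDerivAt_exp_two_mul s).const_mul 2).neg.congr_deriv (by ring)

lemma setIntegral_periodRect_mono {G H : ℝ × ℝ → ℝ} {a b : ℝ}
    (hG : ContinuousOn G (Icc a b ×ˢ Icc 0 (2 * Real.pi)))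
    (hH : ContinuousOn H (Icc a b ×ˢ Icc 0 (2 * Real.pi)))
    (h : ∀ p : ℝ × ℝ, p.1 ≤ b → G p ≤ H p) :
    ∫ p in periodRect a b, G p ≤ ∫ p in periodRect a b, H p :=
  setIntegral_mono_on (integrableOn_periodRect hG) (integrableOn_periodRect hH)
    (measurableSet_periodRect a b) fun p hp => h p hp.1.2

/-- Green's formula with weight `e^{2b} - e^{2s}`: the weighted integral of the Laplacian of a
nonnegative bounded subharmonic function is controlled by its mean over the boundary. -/
lemma integral_laplacian_le {u ux uxx uy uyy : ℂ → ℝ} (hx : HasSecondDeriv 1 leftHalf u ux uxx)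
    (hy : HasSecondDeriv Complex.I leftHalf u uy uyy)
    (hper : ∀ ζ, uy (ζ + 2 * Real.pi * Complex.I) = uy ζ)
    (hL : ∀ ζ ∈ leftHalf, 0 ≤ uxx ζ + uyy ζ) {b C : ℝ} (hb : b < 0) (hC : 0 ≤ C)
    (hu₀ : ∀ ζ, ζ.re ≤ b → 0 ≤ u ζ) (hu : ∀ ζ, ζ.re ≤ b → u ζ ≤ C) {a : ℝ} (hab : a ≤ b) :
    ∫ p in periodRect a b,
      (uxx (planePt p) + uyy (planePt p)) * (Real.exp (2 * b) - Real.exp (2 * p.1)) ≤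
    2 * ∫ θ in (0 : ℝ)..2 * Real.pi, u (planePt (b, θ)) := by
  -- For `ψ = e^{2b} - e^{2s}` one has `ψ'' = -4 e^{2s} ≤ 0`, so the term `-u ψ''` can be dropped,
  -- and `-ψ'(b) = 2 e^{2b} ≤ 2`.
  have h := green_le hx hy hper hL hb hC hu₀ hu (hasDerivAt_weight b) hasDerivAt_weight₁
    (by fun_prop) (sub_self _) (fun s hs => sub_nonneg.2 (Real.exp_le_exp.2 (by linarith)))
    (fun s _ => by simp [(Real.exp_pos _).le]) hab
  have c0 := continuousOn_rect (a := a) hx.cont hb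
  have c2 := continuousOn_rect (a := a) (hx.cont₂.add hy.cont₂) hb
  have hM : 0 ≤ ∫ θ in (0 : ℝ)..2 * Real.pi, u (planePt (b, θ)) :=
    intervalIntegral.integral_nonneg Real.two_pi_pos.le fun θ _ => hu₀ _ (by simp)
  have he : Real.exp (2 * b) ≤ 1 := Real.exp_le_one_iff.2 (by linarith)
  have hcψ : ContinuousOn (fun p : ℝ × ℝ => (uxx (planePt p) + uyy (planePt p)) *
      (Real.exp (2 * b) - Real.exp (2 * p.1))) (Icc a b ×ˢ Icc 0 (2 * Real.pi)) :=
    c2.mul (by fun_prop)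
  refine (setIntegral_periodRect_mono hcψ (hcψ.sub (c0.mul (by fun_prop))) ?_).trans (h.trans ?_)
  · intro p hp
    have h1 := hu₀ (planePt p) (by simpa using hp)
    have h2 := Real.exp_pos (2 * p.1)
    have h3 : 0 ≤ u (planePt p) * (4 * Real.exp (2 * p.1)) := by positivity
    rw [Pi.sub_apply, Pi.mul_apply]
    linarith
  · nlinarith

/-- The cubed weight vanishes at `b` together with its derivative, so no boundary term survives. Its
second derivative is at most `24 e^{2s}` times the uncubed weight, which trades two derivatives for
two powers of the weight. -/
lemma integral_laplacian_cube_le {u ux uxx uy uyy : ℂ → ℝ}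
    (hx : HasSecondDeriv 1 leftHalf u ux uxx)
    (hy : HasSecondDeriv Complex.I leftHalf u uy uyy)
    (hper : ∀ ζ, uy (ζ + 2 * Real.pi * Complex.I) = uy ζ)
    (hL : ∀ ζ ∈ leftHalf, 0 ≤ uxx ζ + uyy ζ) {b C : ℝ} (hb : b < 0) (hC : 0 ≤ C)
    (hu₀ : ∀ ζ, ζ.re ≤ b → 0 ≤ u ζ) (hu : ∀ ζ, ζ.re ≤ b → u ζ ≤ C) {a : ℝ} (hab : a ≤ b) :
    ∫ p in periodRect a b,
      (uxx (planePt p) + uyy (planePt p)) * (Real.exp (2 * b) - Real.exp (2 * p.1)) ^ 3 ≤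
    24 * ∫ p in periodRect a b,
      Real.exp (2 * p.1) * u (planePt p) * (Real.exp (2 * b) - Real.exp (2 * p.1)) := by
  set w : ℝ → ℝ := fun s => Real.exp (2 * b) - Real.exp (2 * s) with hw
  have hw0 : ∀ s ≤ b, 0 ≤ w s := fun s hs => sub_nonneg.2 (Real.exp_le_exp.2 (by linarith))
  have h := green_le hx hy hper hL hb hC hu₀ hu (ψ := fun s => w s ^ 3)
    (ψ₁ := fun s => 3 * w s ^ 2 * (-(2 * Real.exp (2 * s))))
    (ψ₂ := fun s => 24 * w s * Real.exp (2 * s) ^ 2 - 12 * w s ^ 2 * Real.exp (2 * s))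
    (fun s => ((hasDerivAt_weight b s).fun_pow 3).congr_deriv (by simp [hw]))
    (fun s => ((((hasDerivAt_weight b s).fun_pow 2).const_mul 3).mul (hasDerivAt_weight₁ s)).congr_deriv
      (by simp only [hw]; ring))
    (by simp only [hw]; fun_prop) (by simp [hw]) (fun s hs => pow_nonneg (hw0 s hs) 3)
    (fun s _ => mul_nonpos_of_nonneg_of_nonpos (by positivity) (by simp [(Real.exp_pos _).le])) hab
  have c0 := continuousOn_rect (a := a) hx.cont hb
  have c2 := continuousOn_rect (a := a) (hx.cont₂.add hy.cont₂) hb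
  have hcw : Continuous w := by simp only [hw]; fun_prop
  have hcψ : ContinuousOn (fun p : ℝ × ℝ => (uxx (planePt p) + uyy (planePt p)) * w p.1 ^ 3)
      (Icc a b ×ˢ Icc 0 (2 * Real.pi)) := c2.mul (by fun_prop)
  have hcψ₂ : ContinuousOn (fun p : ℝ × ℝ => u (planePt p) * (24 * w p.1 * Real.exp (2 * p.1) ^ 2 -
      12 * w p.1 ^ 2 * Real.exp (2 * p.1)))
      (Icc a b ×ˢ Icc 0 (2 * Real.pi)) := c0.mul (by fun_prop)
  rw [integral_sub (integrableOn_periodRect hcψ) (integrableOn_periodRect hcψ₂)] at h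
  have hwb : w b = 0 := sub_self _
  rw [hwb] at h
  have h2 : ∫ p in periodRect a b, u (planePt p) * (24 * w p.1 * Real.exp (2 * p.1) ^ 2 -
      12 * w p.1 ^ 2 * Real.exp (2 * p.1)) ≤
      ∫ p in periodRect a b, 24 * (Real.exp (2 * p.1) * u (planePt p) * w p.1) := by
    refine setIntegral_periodRect_mono hcψ₂ ?_ fun p hp => ?_
    · exact continuousOn_const.mul (((by fun_prop : ContinuousOn (fun p : ℝ × ℝ =>
        Real.exp (2 * p.1)) _).mul c0).mul (by fun_prop))
    · have h1 := hu₀ (planePt p) (by simpa using hp)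
      have h3 := Real.exp_pos (2 * p.1)
      have h4 : Real.exp (2 * p.1) ≤ 1 :=
        Real.exp_le_one_iff.2 (by linarith [hp.trans hb.le])
      have h5 := hw0 p.1 hp
      have h6 : 24 * w p.1 * Real.exp (2 * p.1) ^ 2 - 12 * w p.1 ^ 2 * Real.exp (2 * p.1) ≤
          24 * w p.1 * Real.exp (2 * p.1) := by
        have : 0 ≤ 12 * w p.1 ^ 2 * Real.exp (2 * p.1) := by positivity
        have : 24 * w p.1 * Real.exp (2 * p.1) ^ 2 ≤ 24 * w p.1 * Real.exp (2 * p.1) := by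
          gcongr
          nlinarith
        linarith
      calc _ ≤ u (planePt p) * (24 * w p.1 * Real.exp (2 * p.1)) :=
            mul_le_mul_of_nonneg_left h6 h1
        _ = _ := by ring
  rw [integral_const_mul] at h2
  simp only [ne_eq, OfNat.ofNat_ne_zero, not_false_eq_true, zero_pow, mul_zero, zero_mul,
    neg_zero] at h
  linarith

/-! ### Littlewood–Paley inequalities -/

section LittlewoodPaley

variable {g : ℂ → ℂ}

lemma sqExp₂_add_nonneg (f : ℂ → ℂ) (ζ : ℂ) : 0 ≤ sqExp₂ f 1 ζ + sqExp₂ f Complex.I ζ := by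
  rw [sqExp₂_add]; positivity

lemma exists_sq_bound_comp_exp (hg : IsAnalytic g) {b : ℝ} (hb : b < 0) :
    ∃ C, 0 ≤ C ∧ ∀ ζ : ℂ, ζ.re ≤ b → ‖g (Complex.exp ζ)‖ ^ 2 ≤ C := by
  obtain ⟨C, hC0, hC⟩ := exists_bound_comp_exp hg hb
  exact ⟨C ^ 2, by positivity, fun ζ hζ => pow_le_pow_left₀ (norm_nonneg _) (hC ζ hζ) 2⟩

lemma ofReal_integral_deriv_le (hg : IsAnalytic g) {a b : ℝ} (hb : b < 0) (hab : a ≤ b) :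
    ENNReal.ofReal (∫ p in periodRect a b, Real.exp (2 * p.1) *
      (4 * ‖deriv g (Complex.exp (planePt p))‖ ^ 2) * (Real.exp (2 * b) - Real.exp (2 * p.1))) ≤
      2 * (ENNReal.ofReal (2 * Real.pi) * hardyNormPow 2 g) := by
  obtain ⟨C, hC0, hC⟩ := exists_sq_bound_comp_exp hg hb
  have h := integral_laplacian_le (hasSecondDeriv_sqExp hg 1) (hasSecondDeriv_sqExp hg Complex.I)
    (sqExp₁_periodic g _) (fun ζ _ => sqExp₂_add_nonneg g ζ) hb hC0 (fun ζ _ => by positivity) hC hab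
  simp_rw [sqExp₂_add, planePt_re] at h
  have h2 := ofReal_integral_circle_le hg (p := 2) two_pos hb
  simp_rw [Real.rpow_two] at h2
  calc _ ≤ ENNReal.ofReal (2 * ∫ θ in (0 : ℝ)..2 * Real.pi,
        ‖g (Complex.exp (planePt (b, θ)))‖ ^ 2) := by
        refine ENNReal.ofReal_le_ofReal (le_trans (le_of_eq ?_) h)
        congr 1
        ext p
        ring
    _ ≤ _ := by
        rw [ENNReal.ofReal_mul two_pos.le, ENNReal.ofReal_ofNat]
        gcongr

/-- The Littlewood–Paley inequality for the first derivative. -/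
theorem lintegral_deriv_le (hg : IsAnalytic g) :
    ∫⁻ z in 𝔻, ENNReal.ofReal (4 * ‖deriv g z‖ ^ 2 * (1 - ‖z‖ ^ 2)) ≤
      4 * (ENNReal.ofReal (2 * Real.pi) * hardyNormPow 2 g) := by
  have hc := (isAnalytic_deriv hg).continuousOn
  have h := lintegral_disc_le (Φ := fun z => 4 * ‖deriv g z‖ ^ 2) (by fun_prop)
    (fun z _ => by positivity) 1 (B := 2 * (ENNReal.ofReal (2 * Real.pi) * hardyNormPow 2 g))
    fun b hb a hab => by simpa only [pow_one] using ofReal_integral_deriv_le hg hb hab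
  simp only [pow_one] at h
  refine h.trans (le_of_eq ?_)
  rw [← mul_assoc]
  norm_num

/-- The Littlewood–Paley inequality for the second derivative. -/
theorem lintegral_deriv_deriv_le (hg : IsAnalytic g) :
    ∫⁻ z in 𝔻, ENNReal.ofReal (4 * ‖deriv (deriv g) z‖ ^ 2 * (1 - ‖z‖ ^ 2) ^ 3) ≤
      96 * (ENNReal.ofReal (2 * Real.pi) * hardyNormPow 2 g) := by
  have hg1 := isAnalytic_deriv hg
  have hc := (isAnalytic_deriv hg1).continuousOn
  have h := lintegral_disc_le (Φ := fun z => 4 * ‖deriv (deriv g) z‖ ^ 2) (by fun_prop)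
    (fun z _ => by positivity) 3 (B := 12 * (ENNReal.ofReal (2 * Real.pi) * hardyNormPow 2 g)) ?_
  · refine h.trans (le_of_eq ?_)
    rw [← mul_assoc]
    norm_num
  intro b hb a hab
  obtain ⟨C, hC0, hC⟩ := exists_sq_bound_comp_exp hg1 hb
  -- The cubed weight applied to `|g'|²` leaves `24 e^{2s} |g'|²` with the simple weight; this is
  -- `6` times the Laplacian of `|g ∘ exp|²`, to which the first-order inequality applies.
  have h := integral_laplacian_cube_le (hasSecondDeriv_sqExp hg1 1)
    (hasSecondDeriv_sqExp hg1 Complex.I) (sqExp₁_periodic _ _)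
    (fun ζ _ => sqExp₂_add_nonneg _ ζ) hb hC0 (fun ζ _ => by positivity) hC hab
  simp_rw [sqExp₂_add, planePt_re] at h
  have h2 := ofReal_integral_deriv_le hg hb hab
  calc _ ≤ ENNReal.ofReal (6 * ∫ p in periodRect a b, Real.exp (2 * p.1) *
      (4 * ‖deriv g (Complex.exp (planePt p))‖ ^ 2) * (Real.exp (2 * b) - Real.exp (2 * p.1))) := by
        refine ENNReal.ofReal_le_ofReal (le_trans (le_of_eq ?_) (h.trans (le_of_eq ?_)))
        · congr 1
          ext p
          ring
        · rw [← integral_const_mul, ← integral_const_mul]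
          congr 1
          ext p
          ring
    _ ≤ 6 * (2 * (ENNReal.ofReal (2 * Real.pi) * hardyNormPow 2 g)) := by
        rw [ENNReal.ofReal_mul (by norm_num), ENNReal.ofReal_ofNat]
        gcongr
    _ = _ := by rw [← mul_assoc]; norm_num

end LittlewoodPaley

/-! ### Carleson embedding by a bounded potential -/

/-- The kernel `(1 - |a|²) / |1 - ā z|²`. -/
noncomputable def poissonK (a z : ℂ) : ℝ := (1 - ‖a‖ ^ 2) / ‖1 - conj a * z‖ ^ 2

/-- The kernel `(1 - |w|²) / |1 - w̄ z|⁴`. -/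
noncomputable def bergK (w z : ℂ) : ℝ := (1 - ‖w‖ ^ 2) / ‖1 - conj w * z‖ ^ 4

lemma poissonK_nonneg {a : ℂ} (ha : a ∈ 𝔻) (z : ℂ) : 0 ≤ poissonK a z :=
  div_nonneg (one_sub_normSq_pos ha).le (by positivity)

lemma bergK_nonneg {a : ℂ} (ha : a ∈ 𝔻) (z : ℂ) : 0 ≤ bergK a z :=
  div_nonneg (one_sub_normSq_pos ha).le (by positivity)

lemma continuousOn_poissonK {a : ℂ} (ha : a ∈ 𝔻) : ContinuousOn (poissonK a) 𝔻 := by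
  unfold poissonK
  refine ContinuousOn.div (by fun_prop) (by fun_prop) fun z hz => ?_
  exact pow_ne_zero _ (norm_one_sub_pos (mem_disc_iff.1 ha).le hz).ne'

lemma continuousOn_bergK {w : ℂ} (hw : w ∈ 𝔻) : ContinuousOn (bergK w) 𝔻 := by
  unfold bergK
  refine ContinuousOn.div (by fun_prop) (by fun_prop) fun z hz => ?_
  exact pow_ne_zero _ (norm_one_sub_pos (mem_disc_iff.1 hw).le hz).ne'

lemma isAnalytic_of_hasDerivAt {f f' : ℂ → ℂ} (h : ∀ z ∈ 𝔻, HasDerivAt f (f' z) z) :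
    IsAnalytic f :=
  DifferentiableOn.analyticOnNhd
    (fun z hz => (h z hz).differentiableAt.differentiableWithinAt) isOpen_ball

lemma hasDerivAt_one_sub (w z : ℂ) : HasDerivAt (fun z => 1 - conj w * z) (-conj w) z := by
  simpa using ((hasDerivAt_id z).const_mul (conj w)).const_sub 1

lemma hasDerivAt_kernel {w z : ℂ} (hw : w ∈ 𝔻) (hz : z ∈ 𝔻) :
    HasDerivAt (fun z => (1 - conj w * z)⁻¹) (conj w / (1 - conj w * z) ^ 2) z := by
  simpa using (hasDerivAt_one_sub w z).fun_inv (one_sub_ne_zero (mem_disc_iff.1 hw).le hz)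

lemma hasDerivAt_id_mul_kernel {w z : ℂ} (hw : w ∈ 𝔻) (hz : z ∈ 𝔻) :
    HasDerivAt (fun z => z * (1 - conj w * z)⁻¹) (1 / (1 - conj w * z) ^ 2) z := by
  have h0 := one_sub_ne_zero (mem_disc_iff.1 hw).le hz
  refine ((hasDerivAt_id z).mul (hasDerivAt_kernel hw hz)).congr_deriv ?_
  simp only [id]
  field_simp
  ring

/-- As a function of its first argument the kernel is a difference of squared moduli of analytic
functions, so its Laplacian can be read off from first derivatives. -/
lemma poissonK_eq_sub {w z : ℂ} :
    poissonK z w = ‖(1 - conj w * z)⁻¹‖ ^ 2 - ‖z * (1 - conj w * z)⁻¹‖ ^ 2 := by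
  rw [poissonK, norm_one_sub_conj_comm, norm_mul, norm_inv]
  ring

/-- The derivatives are `1 / (1 - w̄ z)²` and `w̄ / (1 - w̄ z)²`. Hence `poissonK z w` is
superharmonic in `z`, with Laplacian `-4 * bergK w z`. -/
lemma norm_deriv_kernel_sub {w z : ℂ} (hw : w ∈ 𝔻) (hz : z ∈ 𝔻) :
    ‖deriv (fun z => z * (1 - conj w * z)⁻¹) z‖ ^ 2 - ‖deriv (fun z => (1 - conj w * z)⁻¹) z‖ ^ 2
      = bergK w z := by
  rw [(hasDerivAt_id_mul_kernel hw hz).deriv, (hasDerivAt_kernel hw hz).deriv, norm_div, norm_div,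
    norm_pow, RCLike.norm_conj, norm_one, bergK]
  ring

section Potential

variable {ι : Type*} {s : Finset ι} {c : ι → ℝ} {w : ι → ℂ}

/-- The Carleson potential `∑ cᵢ (1 - |z|²) / |1 - z̄ wᵢ|²`, at `z = exp ζ`. -/
noncomputable def potential (s : Finset ι) (c : ι → ℝ) (w : ι → ℂ) (ζ : ℂ) : ℝ :=
  ∑ i ∈ s, c i * poissonK (Complex.exp ζ) (w i)

lemma exists_hasSecondDeriv_potential (hw : ∀ i, w i ∈ 𝔻) :
    ∃ v₁ v₂ : ℂ → ℂ → ℝ, (∀ e, HasSecondDeriv e leftHalf (potential s c w) (v₁ e) (v₂ e)) ∧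
      (∀ e ζ, v₁ e (ζ + 2 * Real.pi * Complex.I) = v₁ e ζ) ∧
      ∀ ζ ∈ leftHalf, v₂ 1 ζ + v₂ Complex.I ζ =
        -(4 * Real.exp (2 * ζ.re) * ∑ i ∈ s, c i * bergK (w i) (Complex.exp ζ)) := by
  set k : ι → ℂ → ℂ := fun i z => (1 - conj (w i) * z)⁻¹ with hk
  set l : ι → ℂ → ℂ := fun i z => z * (1 - conj (w i) * z)⁻¹ with hl
  have hka : ∀ i, IsAnalytic (k i) := fun i =>
    isAnalytic_of_hasDerivAt fun z hz => hasDerivAt_kernel (hw i) hz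
  have hla : ∀ i, IsAnalytic (l i) := fun i =>
    isAnalytic_of_hasDerivAt fun z hz => hasDerivAt_id_mul_kernel (hw i) hz
  refine ⟨fun e ζ => ∑ i ∈ s, c i * (sqExp₁ (k i) e ζ - sqExp₁ (l i) e ζ),
    fun e ζ => ∑ i ∈ s, c i * (sqExp₂ (k i) e ζ - sqExp₂ (l i) e ζ), fun e => ?_, fun e ζ => ?_,
    fun ζ hζ => ?_⟩
  · have : potential s c w = fun ζ => ∑ i ∈ s, c i * (‖k i (Complex.exp ζ)‖ ^ 2 -
        ‖l i (Complex.exp ζ)‖ ^ 2) := by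
      ext ζ
      simp only [potential, hk, hl, poissonK_eq_sub]
    rw [this]
    exact HasSecondDeriv.sum s fun i _ =>
      ((hasSecondDeriv_sqExp (hka i) e).sub (hasSecondDeriv_sqExp (hla i) e)).const_mul (c i)
  · simp only [sqExp₁_periodic]
  · simp only
    rw [← Finset.sum_add_distrib, Finset.mul_sum, ← Finset.sum_neg_distrib]
    refine Finset.sum_congr rfl fun i _ => ?_
    rw [← norm_deriv_kernel_sub (hw i) (exp_mem_disc hζ)]
    have h1 := sqExp₂_add (k i) ζ
    have h2 := sqExp₂_add (l i) ζ
    simp only [hk, hl] at h1 h2 ⊢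
    linear_combination c i * h1 - c i * h2

/-- The constant of the Carleson embedding theorem for a measure with potential at most `M`. -/
noncomputable def carlesonConst (M p : ℝ) : ℝ := 2 * Real.pi * 2 ^ (p / 2) * Real.exp M

lemma carlesonConst_pos (M p : ℝ) : 0 < carlesonConst M p := by
  unfold carlesonConst; positivity

/-- Green's inequality is applied to `e^W = (|f|² + ε)^{p/2} e^{-v}` with `v` the potential; `ε`
removes the singularity at zeros of `f`. From `Δe^W = e^W (ΔW + |∇W|²)` and `ΔW ≥ -Δv` the Laplacian
dominates the left side, while `0 ≤ v ≤ M` compares `e^W` with powers of `|f|`. -/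
lemma integral_potential_eps_le (hc : ∀ i, 0 ≤ c i) (hw : ∀ i, w i ∈ 𝔻) {M : ℝ}
    (hM : ∀ a ∈ 𝔻, ∑ i ∈ s, c i * poissonK a (w i) ≤ M) {f : ℂ → ℂ} (hf : IsAnalytic f) {p : ℝ}
    (hp : 0 < p) {a b : ℝ} (hb : b < 0) (hab : a ≤ b) {ε : ℝ} (hε : 0 < ε) :
    ∫ q in periodRect a b, Real.exp (2 * q.1) * (4 * Real.exp (-M) *
        (‖f (Complex.exp (planePt q))‖ ^ p *
          ∑ i ∈ s, c i * bergK (w i) (Complex.exp (planePt q)))) *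
        (Real.exp (2 * b) - Real.exp (2 * q.1)) ≤
      2 * ∫ θ in (0 : ℝ)..2 * Real.pi, (‖f (Complex.exp (planePt (b, θ)))‖ ^ 2 + ε) ^ (p / 2) := by
  obtain ⟨v₁, v₂, hv, hvper, hvlap⟩ := exists_hasSecondDeriv_potential (s := s) (c := c) hw
  set N : ℂ → ℝ := fun ζ => ‖f (Complex.exp ζ)‖ ^ 2 + ε with hN
  have hN0 : ∀ ζ, 0 < N ζ := fun ζ => by positivity
  set W : ℂ → ℝ := fun ζ => p / 2 * Real.log (N ζ) - potential s c w ζ with hW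
  set W₁ : ℂ → ℂ → ℝ := fun e ζ => p / 2 * (sqExp₁ f e ζ / N ζ) - v₁ e ζ with hW₁
  set W₂ : ℂ → ℂ → ℝ := fun e ζ =>
    p / 2 * ((sqExp₂ f e ζ * N ζ - sqExp₁ f e ζ * sqExp₁ f e ζ) / N ζ ^ 2) - v₂ e ζ with hW₂
  have hWd : ∀ e, HasSecondDeriv e leftHalf W (W₁ e) (W₂ e) := fun e =>
    ((((hasSecondDeriv_sqExp hf e).add_const ε).log fun ζ _ => hN0 ζ).const_mul (p / 2)).sub (hv e)
  have hWlap : ∀ ζ ∈ leftHalf, 4 * Real.exp (2 * ζ.re) *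
      (∑ i ∈ s, c i * bergK (w i) (Complex.exp ζ)) ≤ W₂ 1 ζ + W₂ Complex.I ζ := by
    intro ζ hζ
    have h1 := hvlap ζ hζ
    have h2 := sqExp₁_sq_add f ζ
    have h3 := sqExp₂_add_nonneg f ζ
    have h4 : W₂ 1 ζ + W₂ Complex.I ζ = p / 2 * (ε * (sqExp₂ f 1 ζ + sqExp₂ f Complex.I ζ)
        / N ζ ^ 2) - (v₂ 1 ζ + v₂ Complex.I ζ) := by
      -- By `|∇|f|²|² = |f|² Δ|f|²` the numerator of `Δ log (|f|² + ε)` collapses to `ε Δ|f|² ≥ 0`.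
      have h5 : (sqExp₂ f 1 ζ * N ζ - sqExp₁ f 1 ζ * sqExp₁ f 1 ζ) + (sqExp₂ f Complex.I ζ * N ζ -
          sqExp₁ f Complex.I ζ * sqExp₁ f Complex.I ζ) =
          ε * (sqExp₂ f 1 ζ + sqExp₂ f Complex.I ζ) := by
        simp only [hN]
        linear_combination -h2
      simp only [hW₂]
      rw [← h5, add_div]
      ring
    rw [h4, h1]
    have h6 : 0 ≤ p / 2 * (ε * (sqExp₂ f 1 ζ + sqExp₂ f Complex.I ζ) / N ζ ^ 2) := by positivity
    linarith
  have hS0 : ∀ z, 0 ≤ ∑ i ∈ s, c i * bergK (w i) z := fun z =>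
    Finset.sum_nonneg fun i _ => mul_nonneg (hc i) (bergK_nonneg (hw i) z)
  have hlap : ∀ ζ ∈ leftHalf, Real.exp (W ζ) * (4 * Real.exp (2 * ζ.re) *
      (∑ i ∈ s, c i * bergK (w i) (Complex.exp ζ))) ≤
      Real.exp (W ζ) * (W₂ 1 ζ + W₁ 1 ζ ^ 2) +
        Real.exp (W ζ) * (W₂ Complex.I ζ + W₁ Complex.I ζ ^ 2) := by
    intro ζ hζ
    rw [← mul_add]
    gcongr
    have := hWlap ζ hζ
    nlinarith [sq_nonneg (W₁ 1 ζ), sq_nonneg (W₁ Complex.I ζ)]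
  have hexpW : ∀ ζ, Real.exp (W ζ) = N ζ ^ (p / 2) * Real.exp (-potential s c w ζ) := fun ζ => by
    rw [Real.rpow_def_of_pos (hN0 ζ), ← Real.exp_add]
    simp only [hW]
    ring_nf
  have hpot0 : ∀ ζ ∈ leftHalf, 0 ≤ potential s c w ζ := fun ζ hζ =>
    Finset.sum_nonneg fun i _ => mul_nonneg (hc i) (poissonK_nonneg (exp_mem_disc hζ) _)
  have hWle : ∀ ζ ∈ leftHalf, Real.exp (W ζ) ≤ N ζ ^ (p / 2) := fun ζ hζ => by
    rw [hexpW]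
    refine mul_le_of_le_one_right (Real.rpow_nonneg (hN0 ζ).le _) ?_
    rw [Real.exp_le_one_iff]
    linarith [hpot0 ζ hζ]
  have hWge : ∀ ζ ∈ leftHalf, ‖f (Complex.exp ζ)‖ ^ p * Real.exp (-M) ≤ Real.exp (W ζ) :=
    fun ζ hζ => by
      rw [hexpW]
      have h1 : ‖f (Complex.exp ζ)‖ ^ p = (‖f (Complex.exp ζ)‖ ^ 2) ^ (p / 2) := by
        rw [← Real.rpow_natCast_mul (norm_nonneg _)]
        congr 1
        push_cast
        ring
      rw [h1]
      have h2 : potential s c w ζ ≤ M := hM _ (exp_mem_disc hζ)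
      gcongr
      simp only [hN]
      linarith
  have hleft : ∀ {ζ : ℂ}, ζ.re ≤ b → ζ ∈ leftHalf := fun h => lt_of_le_of_lt h hb
  obtain ⟨C, hC0, hC⟩ := exists_sq_bound_comp_exp hf hb
  have hx := (hWd 1).exp
  have hy := (hWd Complex.I).exp
  have hmain := integral_laplacian_le hx hy (fun ζ => by
      simp only [hW, hW₁, hN, potential, hvper, sqExp₁_periodic, Complex.exp_periodic ζ])
    (fun ζ hζ => le_trans (mul_nonneg (Real.exp_pos _).le (mul_nonneg (by positivity) (hS0 _)))
      (hlap ζ hζ)) hb (C := (C + ε) ^ (p / 2)) (by positivity)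
    (fun ζ _ => (Real.exp_pos _).le)
    (fun ζ hζ => (hWle ζ (hleft hζ)).trans <| by
      have := hC ζ hζ
      have := (hN0 ζ).le
      simp only [hN] at this ⊢
      gcongr) hab
  have hcontS : ContinuousOn (fun z => ∑ i ∈ s, c i * bergK (w i) z) 𝔻 :=
    continuousOn_finsetSum s fun i _ => continuousOn_const.mul (continuousOn_bergK (hw i))
  have hcontf : ContinuousOn (fun z => ‖f z‖ ^ p) 𝔻 :=
    hf.continuousOn.norm.rpow_const fun _ _ => Or.inr hp.le
  refine (setIntegral_periodRect_mono ?_ ?_ ?_).trans (hmain.trans ?_)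
  · refine ContinuousOn.mul (ContinuousOn.mul (by fun_prop) (continuousOn_const.mul ?_))
      (by fun_prop)
    exact continuousOn_rect (((hcontf.mul hcontS).comp Complex.continuous_exp.continuousOn
      fun _ => exp_mem_disc)) hb
  · exact (continuousOn_rect (hx.cont₂.add hy.cont₂) hb).mul (by fun_prop)
  · intro q hq
    have hqL : planePt q ∈ leftHalf := hleft (by simpa using hq)
    have h1 := hlap _ hqL
    have h2 := hWge _ hqL
    rw [planePt_re] at h1
    have h3 : Real.exp (2 * q.1) ≤ Real.exp (2 * b) := Real.exp_le_exp.2 (by linarith)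
    refine mul_le_mul_of_nonneg_right (le_trans ?_ h1) (by linarith)
    have h4 : 0 ≤ 4 * Real.exp (2 * q.1) *
      (∑ i ∈ s, c i * bergK (w i) (Complex.exp (planePt q))) := mul_nonneg (by positivity) (hS0 _)
    calc _ = ‖f (Complex.exp (planePt q))‖ ^ p * Real.exp (-M) * (4 * Real.exp (2 * q.1) *
      (∑ i ∈ s, c i * bergK (w i) (Complex.exp (planePt q)))) := by ring
      _ ≤ _ := mul_le_mul_of_nonneg_right h2 h4
  · have hcN : Continuous fun θ : ℝ => N (planePt (b, θ)) :=
      continuous_vertical ((hasSecondDeriv_sqExp hf 1).add_const ε).cont hb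
    refine mul_le_mul_of_nonneg_left ?_ two_pos.le
    refine intervalIntegral.integral_mono_on Real.two_pi_pos.le
      ((continuous_vertical hx.cont hb).intervalIntegrable _ _)
      ((hcN.rpow_const fun θ => Or.inr (by positivity)).intervalIntegrable _ _)
      fun θ _ => hWle _ (hleft (by simp))

/-- Splitting off `ε` at the cost of a constant turns the regularisation into an additive error and
avoids a limit under the integral. -/
lemma add_rpow_half_le {x ε p : ℝ} (hx : 0 ≤ x) (hε : 0 ≤ ε) (hp : 0 < p) :
    (x ^ 2 + ε) ^ (p / 2) ≤ 2 ^ (p / 2) * (x ^ p + ε ^ (p / 2)) := by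
  have h1 : x ^ p = (x ^ 2) ^ (p / 2) := by
    rw [← Real.rpow_natCast_mul hx]
    congr 1
    push_cast
    ring
  have hp2 : 0 ≤ p / 2 := by positivity
  calc (x ^ 2 + ε) ^ (p / 2) ≤ (2 * max (x ^ 2) ε) ^ (p / 2) := by
        refine Real.rpow_le_rpow (by positivity) ?_ hp2
        linarith [le_max_left (x ^ 2) ε, le_max_right (x ^ 2) ε]
    _ = 2 ^ (p / 2) * (max (x ^ 2) ε) ^ (p / 2) :=
        Real.mul_rpow two_pos.le (le_max_of_le_right hε)
    _ ≤ 2 ^ (p / 2) * (x ^ p + ε ^ (p / 2)) := by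
        gcongr
        rw [h1]
        rcases max_cases (x ^ 2) ε with h | h <;> rw [h.1]
        · exact le_add_of_nonneg_right (by positivity)
        · exact le_add_of_nonneg_left (by positivity)

lemma integral_potential_le (hc : ∀ i, 0 ≤ c i) (hw : ∀ i, w i ∈ 𝔻) {M : ℝ}
    (hM : ∀ a ∈ 𝔻, ∑ i ∈ s, c i * poissonK a (w i) ≤ M) {f : ℂ → ℂ} (hf : IsAnalytic f) {p : ℝ}
    (hp : 0 < p) {a b : ℝ} (hb : b < 0) (hab : a ≤ b) :
    ∫ q in periodRect a b, Real.exp (2 * q.1) * (4 * Real.exp (-M) *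
        (‖f (Complex.exp (planePt q))‖ ^ p *
          ∑ i ∈ s, c i * bergK (w i) (Complex.exp (planePt q)))) *
        (Real.exp (2 * b) - Real.exp (2 * q.1)) ≤
      2 * 2 ^ (p / 2) * ∫ θ in (0 : ℝ)..2 * Real.pi, ‖f (Complex.exp (planePt (b, θ)))‖ ^ p := by
  refine le_of_forall_pos_le_add fun δ hδ => ?_
  -- With `ε = η ^ (2 / p)` the error `ε ^ (p / 2)` is `η`, chosen so that its total contribution is
  -- exactly `δ`.
  set η : ℝ := δ / (2 * 2 ^ (p / 2) * (2 * Real.pi)) with hη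
  have hη0 : 0 < η := by positivity
  refine (integral_potential_eps_le hc hw hM hf hp hb hab
    (ε := η ^ (2 / p)) (by positivity)).trans ?_
  have hη' : (η ^ (2 / p)) ^ (p / 2) = η := by
    rw [← Real.rpow_mul hη0.le, div_mul_div_cancel₀ hp.ne', div_self two_ne_zero, Real.rpow_one]
  have hcf : Continuous fun θ : ℝ => ‖f (Complex.exp (planePt (b, θ)))‖ :=
    continuous_vertical (continuousOn_comp_exp hf).norm hb
  have hcp : Continuous fun θ : ℝ => ‖f (Complex.exp (planePt (b, θ)))‖ ^ p :=
    hcf.rpow_const fun _ => Or.inr hp.le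
  have h1 : ∫ θ in (0 : ℝ)..2 * Real.pi,
      (‖f (Complex.exp (planePt (b, θ)))‖ ^ 2 + η ^ (2 / p)) ^ (p / 2) ≤
      ∫ θ in (0 : ℝ)..2 * Real.pi, 2 ^ (p / 2) * (‖f (Complex.exp (planePt (b, θ)))‖ ^ p + η) := by
    refine intervalIntegral.integral_mono_on Real.two_pi_pos.le
      ((((hcf.pow 2).add_const _).rpow_const fun θ => Or.inr (by positivity)).intervalIntegrable _ _)
      ((continuous_const.mul (hcp.add_const _)).intervalIntegrable _ _) fun θ _ => ?_
    have := add_rpow_half_le (norm_nonneg (f (Complex.exp (planePt (b, θ)))))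
      (Real.rpow_nonneg hη0.le (2 / p)) hp
    rwa [hη'] at this
  have h2 : ∫ θ in (0 : ℝ)..2 * Real.pi,
      2 ^ (p / 2) * (‖f (Complex.exp (planePt (b, θ)))‖ ^ p + η) =
      2 ^ (p / 2) * (∫ θ in (0 : ℝ)..2 * Real.pi, ‖f (Complex.exp (planePt (b, θ)))‖ ^ p) +
        2 ^ (p / 2) * (2 * Real.pi * η) := by
    rw [intervalIntegral.integral_const_mul, intervalIntegral.integral_add
      (hcp.intervalIntegrable _ _) (by simp), intervalIntegral.integral_const]
    simp only [sub_zero, smul_eq_mul]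
    ring
  have h3 : 2 * (2 ^ (p / 2) * (2 * Real.pi * η)) = δ := by
    rw [hη]; field_simp
  linarith

/-- Carleson's embedding theorem for finitely many point masses, in terms of the Laplacian of the
potential. -/
theorem lintegral_potential_le (hc : ∀ i, 0 ≤ c i) (hw : ∀ i, w i ∈ 𝔻) {M : ℝ}
    (hM : ∀ a ∈ 𝔻, ∑ i ∈ s, c i * poissonK a (w i) ≤ M) {f : ℂ → ℂ} (hf : IsAnalytic f) {p : ℝ}
    (hp : 0 < p) :
    ∫⁻ z in 𝔻, ENNReal.ofReal (‖f z‖ ^ p * (∑ i ∈ s, c i * bergK (w i) z) * (1 - ‖z‖ ^ 2)) ≤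
      ENNReal.ofReal (carlesonConst M p) * hardyNormPow p f := by
  have hS0 : ∀ z, 0 ≤ ∑ i ∈ s, c i * bergK (w i) z := fun z =>
    Finset.sum_nonneg fun i _ => mul_nonneg (hc i) (bergK_nonneg (hw i) z)
  have hcontS : ContinuousOn (fun z => ∑ i ∈ s, c i * bergK (w i) z) 𝔻 :=
    continuousOn_finsetSum s fun i _ => continuousOn_const.mul (continuousOn_bergK (hw i))
  have hcontf : ContinuousOn (fun z => ‖f z‖ ^ p) 𝔻 :=
    hf.continuousOn.norm.rpow_const fun _ _ => Or.inr hp.le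
  have h := lintegral_disc_le
    (Φ := fun z => 4 * Real.exp (-M) * (‖f z‖ ^ p * ∑ i ∈ s, c i * bergK (w i) z))
    (continuousOn_const.mul (hcontf.mul hcontS))
    (fun z _ => mul_nonneg (by positivity) (mul_nonneg (by positivity) (hS0 z))) 1
    (B := ENNReal.ofReal (2 * 2 ^ (p / 2)) * (ENNReal.ofReal (2 * Real.pi) * hardyNormPow p f))
    fun b hb a hab => by
      simp only [pow_one]
      refine (ENNReal.ofReal_le_ofReal (integral_potential_le hc hw hM hf hp hb hab)).trans ?_
      rw [ENNReal.ofReal_mul (by positivity)]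
      exact mul_le_mul_right (ofReal_integral_circle_le hf hp hb) _
  have hfac : ∀ z : ℂ, ENNReal.ofReal (‖f z‖ ^ p * (∑ i ∈ s, c i * bergK (w i) z) * (1 - ‖z‖ ^ 2))
      = ENNReal.ofReal (Real.exp M / 4) * ENNReal.ofReal (4 * Real.exp (-M) *
        (‖f z‖ ^ p * ∑ i ∈ s, c i * bergK (w i) z) * (1 - ‖z‖ ^ 2) ^ 1) := fun z => by
    rw [← ENNReal.ofReal_mul (by positivity), Real.exp_neg]
    congr 1
    field_simp
  simp_rw [hfac]
  rw [lintegral_const_mul' _ _ ENNReal.ofReal_ne_top]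
  refine (mul_le_mul_right h _).trans (le_of_eq ?_)
  rw [← mul_assoc, ← mul_assoc, ← mul_assoc, pow_one, ← ENNReal.ofReal_ofNat,
    ← ENNReal.ofReal_mul (by positivity), ← ENNReal.ofReal_mul (by positivity),
    ← ENNReal.ofReal_mul (by positivity)]
  congr 2
  rw [carlesonConst]
  ring

end Potential

/-! ### From bounded Poisson integrals to Carleson measures -/

/-- The mean value property of the analytic function `A²`, followed by the triangle inequality. -/
lemma two_pi_mul_norm_sq_le_lintegral {A : ℂ → ℂ} {z : ℂ} {r : ℝ}
    (hA : AnalyticOnNhd ℂ A (closedBall z |r|)) :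
    ENNReal.ofReal (2 * Real.pi * ‖A z‖ ^ 2) ≤
      ∫⁻ θ in Ioc 0 (2 * Real.pi), ENNReal.ofReal (‖A (circleMap z r θ)‖ ^ 2) := by
  have h1 : DiffContOnCl ℂ (fun w => A w ^ 2) (ball z |r|) := by
    refine DifferentiableOn.diffContOnCl fun w hw => ?_
    have := (hA w (closure_ball_subset_closedBall hw)).differentiableAt
    exact (this.pow 2).differentiableWithinAt
  have h2 := h1.circleAverage
  rw [Real.circleAverage_def, inv_smul_eq_iff₀ Real.two_pi_pos.ne',
    intervalIntegral.integral_of_le Real.two_pi_pos.le] at h2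
  have h3 : ‖(2 * Real.pi) • A z ^ 2‖ₑ = ENNReal.ofReal (2 * Real.pi * ‖A z‖ ^ 2) := by
    rw [← ofReal_norm, norm_smul, norm_pow, Real.norm_of_nonneg Real.two_pi_pos.le]
  rw [← h3, ← h2]
  refine (enorm_integral_le_lintegral_enorm _).trans (le_of_eq (lintegral_congr fun θ => ?_))
  rw [← ofReal_norm, norm_pow]

/-- The area sub-mean value property of `|A|²`. -/
lemma norm_sq_le_lintegral {A : ℂ → ℂ} {z : ℂ} {r : ℝ} (hr : 0 < r)
    (hA : AnalyticOnNhd ℂ A (closedBall z r)) :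
    ENNReal.ofReal (‖A z‖ ^ 2 * r ^ 2 / 2) ≤
      ∫⁻ w in closedBall z r, ENNReal.ofReal (‖A w‖ ^ 2) := by
  set b := Real.log r with hb
  have hrb : Real.exp b = r := Real.exp_log hr
  set g : ℂ → ℝ≥0∞ := fun v => ENNReal.ofReal (‖A (z + v)‖ ^ 2) with hg
  have hmem : ∀ p : ℝ × ℝ, p.1 ≤ b → z + Complex.exp (planePt p) ∈ closedBall z r := by
    intro p hp
    rw [mem_closedBall, dist_eq_norm, add_sub_cancel_left, Complex.norm_exp, planePt_re, ← hrb]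
    exact Real.exp_le_exp.2 hp
  have hmeas : AEMeasurable (fun p : ℝ × ℝ =>
      ENNReal.ofReal (Real.exp (2 * p.1)) * g (Complex.exp (planePt p)))
      (((volume : Measure ℝ).prod (volume : Measure ℝ)).restrict
        (Ioc (b - 1) b ×ˢ Ioc 0 (2 * Real.pi))) := by
    refine AEMeasurable.mul (by fun_prop) (AEMeasurable.ennreal_ofReal ?_)
    refine ContinuousOn.aemeasurable ?_ (measurableSet_periodRect _ _)
    refine (ContinuousOn.comp hA.continuousOn ?_ fun p hp => hmem p hp.1.2).norm.pow 2
    exact (continuous_const.add (Complex.continuous_exp.comp continuous_planePt)).continuousOn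
  have h1 : ∫⁻ v in {v | Real.exp (b - 1) < ‖v‖ ∧ ‖v‖ ≤ Real.exp b}, g v ≤
      ∫⁻ w in closedBall z r, ENNReal.ofReal (‖A w‖ ^ 2) := by
    have h2 := (measurePreserving_add_left (volume : Measure ℂ) z).setLIntegral_comp_preimage_emb
      (measurableEmbedding_addLeft z) (fun w => ENNReal.ofReal (‖A w‖ ^ 2)) (closedBall z r)
    rw [← h2]
    refine lintegral_mono_set fun v hv => ?_
    rw [mem_preimage, mem_closedBall, dist_eq_norm, add_sub_cancel_left, ← hrb]
    exact hv.2
  refine le_trans ?_ h1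
  rw [lintegral_annulus, periodRect, Measure.volume_eq_prod, setLIntegral_prod _ hmeas]
  -- Only the annulus `r / e < |v| ≤ r` is used: it has logarithmic width `1`, and `e² ≤ 9` with `2π
  -- / 9 ≥ 1 / 2` gives the constant.
  have h3 : ∀ s ∈ Ioc (b - 1) b, ENNReal.ofReal (‖A z‖ ^ 2 * r ^ 2 / 2) ≤
      ∫⁻ θ in Ioc 0 (2 * Real.pi),
        ENNReal.ofReal (Real.exp (2 * s)) * g (Complex.exp (planePt (s, θ))) := by
    intro s hs
    rw [lintegral_const_mul' _ _ ENNReal.ofReal_ne_top]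
    have h4 := two_pi_mul_norm_sq_le_lintegral (A := A) (z := z) (r := Real.exp s) <| by
      refine hA.mono (closedBall_subset_closedBall ?_)
      rw [abs_of_pos (Real.exp_pos s), ← hrb]
      exact Real.exp_le_exp.2 hs.2
    have h5 : ∀ θ : ℝ, ENNReal.ofReal (‖A (circleMap z (Real.exp s) θ)‖ ^ 2) =
        g (Complex.exp (planePt (s, θ))) := fun θ => by
      simp [hg, circleMap, planePt, Complex.exp_add]
    simp_rw [h5] at h4
    refine le_trans ?_ (mul_le_mul_right h4 _)
    rw [← ENNReal.ofReal_mul (Real.exp_pos _).le]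
    apply ENNReal.ofReal_le_ofReal
    have h6 : r ^ 2 / 9 ≤ Real.exp (2 * s) := by
      have h7 : Real.exp (2 * (b - 1)) ≤ Real.exp (2 * s) := Real.exp_le_exp.2 (by linarith [hs.1])
      have h8 : Real.exp (2 * (b - 1)) = r ^ 2 / Real.exp 1 ^ 2 := by
        rw [← hrb, ← Real.exp_nat_mul, ← Real.exp_nat_mul, ← Real.exp_sub]
        congr 1
        push_cast
        ring
      have h9 : Real.exp 1 ^ 2 ≤ 9 := by
        nlinarith [Real.exp_one_lt_d9, Real.exp_pos 1]
      rw [h8] at h7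
      refine le_trans ?_ h7
      gcongr
    have hpi := Real.pi_gt_three
    have : 0 ≤ ‖A z‖ ^ 2 := by positivity
    calc ‖A z‖ ^ 2 * r ^ 2 / 2 ≤ r ^ 2 / 9 * (2 * Real.pi * ‖A z‖ ^ 2) := by
          have : 0 ≤ ‖A z‖ ^ 2 * r ^ 2 := by positivity
          nlinarith
      _ ≤ _ := by gcongr
  calc ENNReal.ofReal (‖A z‖ ^ 2 * r ^ 2 / 2)
      = ∫⁻ _ in Ioc (b - 1) b, ENNReal.ofReal (‖A z‖ ^ 2 * r ^ 2 / 2) := by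
        rw [setLIntegral_const, Real.volume_Ioc]; simp
    _ ≤ _ := setLIntegral_mono' measurableSet_Ioc h3

lemma norm_one_sub_le_of_norm_sub_le {z w : ℂ} (hz : z ∈ 𝔻)
    (hw : ‖w - z‖ ≤ (1 - ‖z‖ ^ 2) / 4) :
    w ∈ 𝔻 ∧ (1 - ‖z‖ ^ 2) / 4 ≤ 1 - ‖w‖ ^ 2 ∧ ‖1 - conj w * z‖ ≤ 5 / 4 * (1 - ‖z‖ ^ 2) := by
  have h1 : ‖w‖ - ‖z‖ ≤ ‖w - z‖ := norm_sub_norm_le _ _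
  have h2 := mem_disc_iff.1 hz
  have h3 : 1 - ‖z‖ ^ 2 ≤ 2 * (1 - ‖z‖) := by nlinarith [norm_nonneg z]
  have h4 := one_sub_normSq_pos hz
  have h5 : ‖w‖ ≤ 1 - (1 - ‖z‖ ^ 2) / 4 := by linarith
  refine ⟨mem_disc_iff.2 (by linarith), by nlinarith [norm_nonneg w], ?_⟩
  linarith [norm_one_sub_conj_le z w h2.le]

/-- The density of `coeffMeasure A`. -/
noncomputable def coeffDensity (A : ℂ → ℂ) (z : ℂ) : ℝ := ‖A z‖ ^ 2 * (1 - ‖z‖ ^ 2) ^ 3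

lemma coeffDensity_nonneg (A : ℂ → ℂ) {z : ℂ} (hz : z ∈ 𝔻) : 0 ≤ coeffDensity A z :=
  mul_nonneg (by positivity) (pow_nonneg (one_sub_normSq_pos hz).le 3)

lemma continuousOn_coeffDensity {A : ℂ → ℂ} (hA : IsAnalytic A) :
    ContinuousOn (coeffDensity A) 𝔻 := by
  have := hA.continuousOn
  unfold coeffDensity
  fun_prop

/-- The density is dominated by its average against the kernel `bergK`. -/
lemma coeffDensity_le_lintegral {A : ℂ → ℂ} (hA : IsAnalytic A) {z : ℂ} (hz : z ∈ 𝔻) :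
    ENNReal.ofReal (‖A z‖ ^ 2 * (1 - ‖z‖ ^ 2) ^ 2) ≤
      20000 * ∫⁻ w in 𝔻, ENNReal.ofReal (coeffDensity A w * bergK w z) := by
  set d := 1 - ‖z‖ ^ 2 with hd
  have hd0 : 0 < d := one_sub_normSq_pos hz
  have hsub : ∀ w ∈ closedBall z (d / 4), w ∈ 𝔻 ∧ d / 4 ≤ 1 - ‖w‖ ^ 2 ∧
      ‖1 - conj w * z‖ ≤ 5 / 4 * d := fun w hw =>
    norm_one_sub_le_of_norm_sub_le hz (by rwa [mem_closedBall, dist_eq_norm] at hw)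
  -- On this disc the ratio `(1 - |w|²) / |1 - w̄ z|` is at least `1 / 5`, whence `625 = 5⁴`. The
  -- radius `d / 4` and the factor `1 / 2` cost `32`, and `32 * 625 = 20000`.
  have h1 := norm_sq_le_lintegral (A := A) (z := z) (r := d / 4) (by positivity)
    fun w hw => hA w (hsub w hw).1
  have h2 : ∫⁻ w in closedBall z (d / 4), ENNReal.ofReal (‖A w‖ ^ 2) ≤
      625 * ∫⁻ w in 𝔻, ENNReal.ofReal (coeffDensity A w * bergK w z) := by
    rw [← lintegral_const_mul' _ _ (by simp)]
    calc _ ≤ ∫⁻ w in closedBall z (d / 4),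
          625 * ENNReal.ofReal (coeffDensity A w * bergK w z) := by
          refine setLIntegral_mono' measurableSet_closedBall fun w hw => ?_
          obtain ⟨h3, h4, h5⟩ := hsub w hw
          rw [← ENNReal.ofReal_ofNat, ← ENNReal.ofReal_mul (by norm_num)]
          apply ENNReal.ofReal_le_ofReal
          have h6 := norm_one_sub_pos (mem_disc_iff.1 h3).le hz
          have h7 : (d / 4) ^ 4 / (5 / 4 * d) ^ 4 ≤
              (1 - ‖w‖ ^ 2) ^ 4 / ‖1 - conj w * z‖ ^ 4 := by gcongr
          have h8 : (d / 4) ^ 4 / (5 / 4 * d) ^ 4 = 1 / 625 := by field_simp; norm_num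
          rw [h8] at h7
          calc ‖A w‖ ^ 2 = 625 * (‖A w‖ ^ 2 * (1 / 625)) := by ring
            _ ≤ 625 * (‖A w‖ ^ 2 * ((1 - ‖w‖ ^ 2) ^ 4 / ‖1 - conj w * z‖ ^ 4)) := by gcongr
            _ = _ := by rw [coeffDensity, bergK]; ring
      _ ≤ _ := lintegral_mono_set fun w hw => (hsub w hw).1
  have h3 := h1.trans h2
  calc ENNReal.ofReal (‖A z‖ ^ 2 * d ^ 2)
      = 32 * ENNReal.ofReal (‖A z‖ ^ 2 * (d / 4) ^ 2 / 2) := by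
        rw [← ENNReal.ofReal_ofNat, ← ENNReal.ofReal_mul (by norm_num)]
        congr 1
        ring
    _ ≤ 32 * (625 * ∫⁻ w in 𝔻, ENNReal.ofReal (coeffDensity A w * bergK w z)) := by gcongr
    _ = _ := by rw [← mul_assoc]; norm_num

lemma poissonK_le_of_mem_pseudoDisc {a z w : ℂ} {δ : ℝ} (hδ₀ : 0 < δ) (hδ : δ < 1) (ha : a ∈ 𝔻)
    (hz : z ∈ 𝔻) (hw : w ∈ pseudoDisc z δ) :
    poissonK a z ≤ harnackConst δ ^ 2 * poissonK a w := by
  have h1 := norm_one_sub_le_of_mem_pseudoDisc hδ₀ hδ (mem_disc_iff.1 ha).le hw.1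
    (mem_pseudoDisc_symm hz hw)
  have h2 := one_sub_normSq_pos ha
  have h3 := norm_one_sub_pos (mem_disc_iff.1 ha).le hz
  have h4 := norm_one_sub_pos (mem_disc_iff.1 ha).le hw.1
  rw [poissonK, poissonK, mul_div_assoc', div_le_div_iff₀ (by positivity) (by positivity)]
  calc (1 - ‖a‖ ^ 2) * ‖1 - conj a * w‖ ^ 2 ≤
      (1 - ‖a‖ ^ 2) * (harnackConst δ * ‖1 - conj a * z‖) ^ 2 := by gcongr
    _ = _ := by ring

/-- One factor of the constant is due to `1 - |w|²` and four to the denominator. -/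
lemma bergK_le_of_mem_pseudoDisc {z v w : ℂ} {δ : ℝ} (hδ₀ : 0 < δ) (hδ : δ < 1) (hz : z ∈ 𝔻)
    (hv : v ∈ 𝔻) (hw : w ∈ pseudoDisc v δ) :
    bergK w z ≤ harnackConst δ ^ 5 * bergK v z := by
  have h0 := one_le_harnackConst hδ₀ hδ
  have h1 := norm_one_sub_le_of_mem_pseudoDisc hδ₀ hδ (mem_disc_iff.1 hz).le hv hw
  have h2 := one_sub_normSq_le_of_mem_pseudoDisc hδ₀ hδ hw.1 (mem_pseudoDisc_symm hv hw)
  have h3 := norm_one_sub_pos (mem_disc_iff.1 hv).le hz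
  have h4 := norm_one_sub_pos (mem_disc_iff.1 hw.1).le hz
  have h5 := one_sub_normSq_pos hv
  rw [norm_one_sub_conj_comm] at h3 h4
  rw [bergK, bergK, norm_one_sub_conj_comm z v, norm_one_sub_conj_comm z w, mul_div_assoc',
    div_le_div_iff₀ (by positivity) (by positivity)]
  calc (1 - ‖w‖ ^ 2) * ‖1 - conj z * v‖ ^ 4 ≤
      (harnackConst δ * (1 - ‖v‖ ^ 2)) * (harnackConst δ * ‖1 - conj z * w‖) ^ 4 := by gcongr
    _ = _ := by ring

/-- A countable measurable partition of the disc subordinate to pseudo-hyperbolic discs. -/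
lemma exists_partition : ∃ (w : ℕ → ℂ) (Q : ℕ → Set ℂ), (∀ n, w n ∈ 𝔻) ∧
    (∀ n, MeasurableSet (Q n)) ∧ Pairwise (Function.onFun Disjoint Q) ∧
    (∀ n, Q n ⊆ pseudoDisc (w n) (1 / 2)) ∧ ⋃ n, Q n = 𝔻 := by
  have : Nonempty 𝔻 := ⟨⟨0, by simp⟩⟩
  obtain ⟨u, hu⟩ := TopologicalSpace.exists_dense_seq 𝔻
  refine ⟨fun n => u n, disjointed fun n => pseudoDisc (u n) (1 / 2), fun n => (u n).2, ?_,
    disjoint_disjointed _, disjointed_subset _, ?_⟩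
  · exact MeasurableSet.disjointed fun n => (isOpen_pseudoDisc (u n).2).measurableSet
  · rw [iUnion_disjointed]
    refine Subset.antisymm (iUnion_subset fun n z hz => hz.1) fun z hz => ?_
    -- Some member of the dense sequence lies in the pseudo-disc about `z`; by symmetry `z` lies in
    -- the pseudo-disc about that member.
    have hopen : IsOpen {v : 𝔻 | (v : ℂ) ∈ pseudoDisc z (1 / 2)} :=
      (isOpen_pseudoDisc hz).preimage continuous_subtype_val
    obtain ⟨n, hn⟩ := hu.exists_mem_open hopen
      ⟨⟨z, hz⟩, mem_pseudoDisc_self (by norm_num) hz⟩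
    exact mem_iUnion.2 ⟨n, mem_pseudoDisc_symm hz hn⟩

/-- The reproducing kernel thesis: `coeffMeasure A` is a Carleson measure as soon as its Poisson
integral is bounded. -/
theorem isCarleson_coeffMeasure {A : ℂ → ℂ} (hA : IsAnalytic A) {M : ℝ}
    (hM : ∀ a ∈ 𝔻, ∫⁻ z in 𝔻, ENNReal.ofReal (poissonK a z * coeffDensity A z) ≤
      ENNReal.ofReal M) : IsCarleson (coeffMeasure A) := by
  obtain ⟨w, Q, hw, hQm, hQd, hQs, hQU⟩ := exists_partition
  set K := harnackConst (1 / 2) with hK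
  have hK1 : 1 ≤ K := one_le_harnackConst (by norm_num) (by norm_num)
  have hK0 : 0 ≤ K := by linarith
  have hQD : ∀ n, Q n ⊆ 𝔻 := fun n z hz => (hQs n hz).1
  set m : ℕ → ℝ≥0∞ := fun n => ∫⁻ z in Q n, ENNReal.ofReal (coeffDensity A z) with hm
  have hmtop : ∀ n, m n ≠ ∞ := by
    intro n
    -- At `a = 0` the kernel is `1`, so the hypothesis contains the finiteness of the total mass.
    have h1 := hM 0 (by simp)
    have h2 : ∀ z, poissonK 0 z = 1 := fun z => by simp [poissonK]
    simp_rw [h2, one_mul] at h1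
    exact ne_top_of_le_ne_top ENNReal.ofReal_ne_top ((lintegral_mono_set (hQD n)).trans h1)
  set c : ℕ → ℝ := fun n => (m n).toReal with hc
  have hc0 : ∀ n, 0 ≤ c n := fun n => ENNReal.toReal_nonneg
  have hcm : ∀ n, ENNReal.ofReal (c n) = m n := fun n => ENNReal.ofReal_toReal (hmtop n)
  have htotal : ∀ g : ℂ → ℝ≥0∞, ∑' n, ∫⁻ z in Q n, g z = ∫⁻ z in 𝔻, g z := fun g => by
    rw [← hQU, lintegral_iUnion hQm hQd]
  -- The masses of the cells are moved to the centres `w n`. The bound does not depend on `s`, so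
  -- the embedding constant survives the passage to infinitely many masses.
  have hpot : ∀ s : Finset ℕ, ∀ a ∈ 𝔻, ∑ i ∈ s, c i * poissonK a (w i) ≤ K ^ 2 * max M 0 := by
    intro s a ha
    have hnn : 0 ≤ K ^ 2 * max M 0 := mul_nonneg (by positivity) (le_max_right _ _)
    rw [← ENNReal.ofReal_le_ofReal_iff hnn,
      ENNReal.ofReal_sum_of_nonneg fun i _ => mul_nonneg (hc0 i) (poissonK_nonneg ha _)]
    calc ∑ i ∈ s, ENNReal.ofReal (c i * poissonK a (w i))
        ≤ ∑ i ∈ s, ENNReal.ofReal (K ^ 2) *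
            ∫⁻ z in Q i, ENNReal.ofReal (poissonK a z * coeffDensity A z) := by
          refine Finset.sum_le_sum fun i _ => ?_
          rw [ENNReal.ofReal_mul (hc0 i), hcm, ← lintegral_const_mul' _ _ ENNReal.ofReal_ne_top,
            ← lintegral_mul_const' _ _ ENNReal.ofReal_ne_top]
          refine setLIntegral_mono' (hQm i) fun z hz => ?_
          have hz1 := coeffDensity_nonneg A (hQD i hz)
          rw [← ENNReal.ofReal_mul hz1, ← ENNReal.ofReal_mul (by positivity)]
          apply ENNReal.ofReal_le_ofReal
          have := poissonK_le_of_mem_pseudoDisc (by norm_num) (by norm_num) ha (hw i) (hQs i hz)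
          nlinarith
      _ ≤ ENNReal.ofReal (K ^ 2) *
            ∫⁻ z in 𝔻, ENNReal.ofReal (poissonK a z * coeffDensity A z) := by
          rw [← Finset.mul_sum, ← htotal]
          gcongr
          exact ENNReal.sum_le_tsum s
      _ ≤ ENNReal.ofReal (K ^ 2 * max M 0) := by
          rw [ENNReal.ofReal_mul (by positivity)]
          gcongr
          exact (hM a ha).trans (ENNReal.ofReal_le_ofReal (le_max_left _ _))
  have hdens : ∀ z ∈ 𝔻, ENNReal.ofReal (‖A z‖ ^ 2 * (1 - ‖z‖ ^ 2) ^ 2) ≤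
      ENNReal.ofReal (20000 * K ^ 5) * ∑' n, ENNReal.ofReal (c n * bergK (w n) z) := by
    intro z hz
    refine (coeffDensity_le_lintegral hA hz).trans ?_
    rw [ENNReal.ofReal_mul (by norm_num), ENNReal.ofReal_ofNat, mul_assoc, ← htotal,
      ← ENNReal.tsum_mul_left (a := ENNReal.ofReal (K ^ 5))]
    refine mul_le_mul_right (ENNReal.tsum_le_tsum fun n => ?_) _
    rw [ENNReal.ofReal_mul (hc0 n), hcm, ← mul_assoc, mul_comm, ← mul_assoc,
      ← lintegral_const_mul' _ _ (by finiteness)]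
    refine setLIntegral_mono' (hQm n) fun v hv => ?_
    have hv1 := coeffDensity_nonneg A (hQD n hv)
    have hb := bergK_nonneg (hw n) z
    rw [← ENNReal.ofReal_mul hb, ← ENNReal.ofReal_mul (by positivity)]
    apply ENNReal.ofReal_le_ofReal
    have := bergK_le_of_mem_pseudoDisc (by norm_num) (by norm_num) hz (hw n) (hQs n hv)
    nlinarith
  intro p hp
  have hCpos : 0 < 20000 * K ^ 5 * carlesonConst (K ^ 2 * max M 0) p :=
    mul_pos (by positivity) (carlesonConst_pos _ _)
  refine ⟨(20000 * K ^ 5 * carlesonConst (K ^ 2 * max M 0) p).toNNReal, by simpa using hCpos,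
    fun f hf => ?_⟩
  have hcontf : ContinuousOn (fun z => ‖f z‖ ^ p) 𝔻 :=
    hf.continuousOn.norm.rpow_const fun _ _ => Or.inr hp.le
  have hmeasD : AEMeasurable (fun z => ENNReal.ofReal (‖A z‖ ^ 2 * (1 - ‖z‖ ^ 2) ^ 3))
      (volume.restrict 𝔻) :=
    ((continuousOn_coeffDensity hA).aemeasurable measurableSet_ball).ennreal_ofReal
  -- The values of `f` off the disc are arbitrary, so `f` need not be measurable; finiteness of the
  -- density makes the product formula available nevertheless.
  rw [coeffMeasure, setLIntegral_withDensity_eq_setLIntegral_mul_non_measurable₀ _ hmeasD.restrict _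
    measurableSet_ball (.of_forall fun _ => ENNReal.ofReal_lt_top),
    Measure.restrict_restrict measurableSet_ball, inter_self]
  calc ∫⁻ z in 𝔻, ((fun z => ENNReal.ofReal (‖A z‖ ^ 2 * (1 - ‖z‖ ^ 2) ^ 3)) *
        fun z => ‖f z‖ₑ ^ p) z
      ≤ ∫⁻ z in 𝔻, ENNReal.ofReal (20000 * K ^ 5) *
          ∑' n, ENNReal.ofReal (‖f z‖ ^ p * (c n * bergK (w n) z) * (1 - ‖z‖ ^ 2)) := by
        refine setLIntegral_mono' measurableSet_ball fun z hz => ?_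
        have hd := one_sub_normSq_pos hz
        have h1 : ENNReal.ofReal (‖A z‖ ^ 2 * (1 - ‖z‖ ^ 2) ^ 3) =
            ENNReal.ofReal (‖A z‖ ^ 2 * (1 - ‖z‖ ^ 2) ^ 2) * ENNReal.ofReal (1 - ‖z‖ ^ 2) := by
          rw [← ENNReal.ofReal_mul (by positivity)]
          congr 1
          ring
        have h2 : ‖f z‖ₑ ^ p = ENNReal.ofReal (‖f z‖ ^ p) := by
          rw [← ENNReal.ofReal_rpow_of_nonneg (norm_nonneg _) hp.le, ofReal_norm]
        have h3 : ∀ n, ENNReal.ofReal (‖f z‖ ^ p * (c n * bergK (w n) z) * (1 - ‖z‖ ^ 2)) =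
            ENNReal.ofReal (‖f z‖ ^ p) * ENNReal.ofReal (1 - ‖z‖ ^ 2) *
              ENNReal.ofReal (c n * bergK (w n) z) := fun n => by
          rw [← ENNReal.ofReal_mul (by positivity), ← ENNReal.ofReal_mul (by positivity)]
          congr 1
          ring
        simp_rw [h3]
        rw [ENNReal.tsum_mul_left, Pi.mul_apply, h1, h2]
        calc _ ≤ ENNReal.ofReal (20000 * K ^ 5) * (∑' n, ENNReal.ofReal (c n * bergK (w n) z)) *
              ENNReal.ofReal (1 - ‖z‖ ^ 2) * ENNReal.ofReal (‖f z‖ ^ p) := by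
              gcongr
              exact hdens z hz
          _ = _ := by ring
    _ = ENNReal.ofReal (20000 * K ^ 5) * ∑' n,
          ∫⁻ z in 𝔻, ENNReal.ofReal (‖f z‖ ^ p * (c n * bergK (w n) z) * (1 - ‖z‖ ^ 2)) := by
        rw [lintegral_const_mul' _ _ ENNReal.ofReal_ne_top, lintegral_tsum fun n => ?_]
        have := continuousOn_bergK (hw n)
        exact ((ContinuousOn.mul (hcontf.mul (continuousOn_const.mul this))
          (by fun_prop)).aemeasurable measurableSet_ball).ennreal_ofReal
    _ ≤ ENNReal.ofReal (20000 * K ^ 5) *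
          (ENNReal.ofReal (carlesonConst (K ^ 2 * max M 0) p) * hardyNormPow p f) := by
        gcongr
        refine ENNReal.tsum_le_of_sum_range_le fun n => ?_
        rw [← lintegral_finsetSum' _ fun i _ => ?_]
        · refine le_trans (setLIntegral_mono' measurableSet_ball fun z hz => ?_)
            (lintegral_potential_le hc0 hw (hpot (Finset.range n)) hf hp)
          have hd := one_sub_normSq_pos hz
          rw [← ENNReal.ofReal_sum_of_nonneg fun i _ => mul_nonneg (mul_nonneg (by positivity)
            (mul_nonneg (hc0 i) (bergK_nonneg (hw i) z))) hd.le, Finset.mul_sum, Finset.sum_mul]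
        · have := continuousOn_bergK (hw i)
          exact ((ContinuousOn.mul (hcontf.mul (continuousOn_const.mul this))
            (by fun_prop)).aemeasurable measurableSet_ball).ennreal_ofReal
    _ = _ := by
        rw [← mul_assoc, ← ENNReal.ofReal_mul (by positivity)]
        rfl

/-! ### Disc automorphisms -/

section DiscAut

variable {a z : ℂ}

lemma one_sub_norm_discAut_sq (ha : a ∈ 𝔻) (hz : z ∈ 𝔻) :
    1 - ‖discAut a z‖ ^ 2 = poissonK a z * (1 - ‖z‖ ^ 2) := by
  have h0 := norm_one_sub_pos (mem_disc_iff.1 ha).le hz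
  have h := norm_one_sub_sq_sub z a
  rw [discAut, norm_div, poissonK]
  generalize ‖1 - conj a * z‖ = t at *
  field_simp
  linarith

lemma discAut_mem_disc (ha : a ∈ 𝔻) (hz : z ∈ 𝔻) : discAut a z ∈ 𝔻 := by
  have h0 := norm_one_sub_pos (mem_disc_iff.1 ha).le hz
  have h := one_sub_norm_discAut_sq ha hz
  have h2 : 0 < poissonK a z * (1 - ‖z‖ ^ 2) :=
    mul_pos (div_pos (one_sub_normSq_pos ha) (by positivity)) (one_sub_normSq_pos hz)
  rw [mem_disc_iff]
  nlinarith [norm_nonneg (discAut a z)]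

lemma discAut_discAut (ha : a ∈ 𝔻) (hz : z ∈ 𝔻) : discAut a (discAut a z) = z := by
  have h0 := one_sub_ne_zero (mem_disc_iff.1 ha).le hz
  have h1 := one_sub_ne_zero (mem_disc_iff.1 ha).le (discAut_mem_disc ha hz)
  have hq : discAut a z * (1 - conj a * z) = a - z := div_mul_cancel₀ _ h0
  rw [discAut, div_eq_iff h1]
  apply mul_right_cancel₀ h0
  linear_combination (z * conj a - 1) * hq

lemma hasDerivAt_discAut (ha : a ∈ 𝔻) (hz : z ∈ 𝔻) :
    HasDerivAt (discAut a) (-(1 - ‖a‖ ^ 2 : ℝ) / (1 - conj a * z) ^ 2) z := by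
  have h0 := one_sub_ne_zero (mem_disc_iff.1 ha).le hz
  refine (((hasDerivAt_id z).const_sub a).div (hasDerivAt_one_sub a z) h0).congr_deriv ?_
  have h := Complex.conj_mul' a
  push_cast
  rw [← h]
  simp only [id]
  ring

lemma hasDerivAt_deriv_discAut (ha : a ∈ 𝔻) (hz : z ∈ 𝔻) :
    HasDerivAt (fun z => -(1 - ‖a‖ ^ 2 : ℝ) / (1 - conj a * z) ^ 2)
      (-(1 - ‖a‖ ^ 2 : ℝ) * (2 * conj a) / (1 - conj a * z) ^ 3) z := by
  have h0 := one_sub_ne_zero (mem_disc_iff.1 ha).le hz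
  refine (((hasDerivAt_one_sub a z).fun_pow 2).fun_inv (pow_ne_zero 2 h0)
    |>.const_mul (-((1 - ‖a‖ ^ 2 : ℝ) : ℂ))).congr_deriv ?_
  field_simp
  push_cast
  ring

lemma norm_deriv_discAut (ha : a ∈ 𝔻) :
    ‖-((1 - ‖a‖ ^ 2 : ℝ) : ℂ) / (1 - conj a * z) ^ 2‖ = poissonK a z := by
  rw [norm_div, norm_neg, Complex.norm_real, norm_pow, Real.norm_of_nonneg
    (one_sub_normSq_pos ha).le, poissonK]

/-- Here `|φ_a''| = 2 |a| |φ_a'| / |1 - ā z|`, and `1 - |z|² ≤ 2 |1 - ā z|`. -/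
lemma norm_deriv_deriv_discAut_le (ha : a ∈ 𝔻) (hz : z ∈ 𝔻) :
    ‖-((1 - ‖a‖ ^ 2 : ℝ) : ℂ) * (2 * conj a) / (1 - conj a * z) ^ 3‖ ≤
      4 * poissonK a z / (1 - ‖z‖ ^ 2) := by
  have h0 := norm_one_sub_pos (mem_disc_iff.1 ha).le hz
  have h1 := one_sub_norm_le_norm_one_sub (z := z) (mem_disc_iff.1 ha).le
  have h2 := mem_disc_iff.1 hz
  have h3 := one_sub_normSq_pos hz
  have h4 := one_sub_normSq_pos ha
  have h5 : 1 - ‖z‖ ^ 2 ≤ 2 * ‖1 - conj a * z‖ := by nlinarith [norm_nonneg z]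
  rw [norm_div, norm_mul, norm_neg, Complex.norm_real, norm_pow, Real.norm_of_nonneg h4.le,
    norm_mul, RCLike.norm_conj, RCLike.norm_ofNat, poissonK, mul_div_assoc', div_div,
    div_le_div_iff₀ (by positivity) (by positivity)]
  have h6 := (mem_disc_iff.1 ha).le
  calc (1 - ‖a‖ ^ 2) * (2 * ‖a‖) * (‖1 - conj a * z‖ ^ 2 * (1 - ‖z‖ ^ 2))
      ≤ (1 - ‖a‖ ^ 2) * (2 * 1) * (‖1 - conj a * z‖ ^ 2 * (2 * ‖1 - conj a * z‖)) := by gcongr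
    _ = _ := by ring

lemma image_discAut (ha : a ∈ 𝔻) : discAut a '' 𝔻 = 𝔻 :=
  Subset.antisymm (image_subset_iff.2 fun _ hz => discAut_mem_disc ha hz)
    fun z hz => ⟨discAut a z, discAut_mem_disc ha hz, discAut_discAut ha hz⟩

lemma injOn_discAut (ha : a ∈ 𝔻) : InjOn (discAut a) 𝔻 := fun z hz w hw h => by
  rw [← discAut_discAut ha hz, h, discAut_discAut ha hw]

end DiscAut

/-! ### Poisson integrals for `BMOA` -/

section BMOA

variable {f : ℂ → ℂ} {a : ℂ}

lemma isAnalytic_comp_discAut (hf : IsAnalytic f) (ha : a ∈ 𝔻) :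
    IsAnalytic fun z => f (discAut a z) - f a :=
  isAnalytic_of_hasDerivAt fun _ hz =>
    ((hf _ (discAut_mem_disc ha hz)).differentiableAt.hasDerivAt.comp _
      (hasDerivAt_discAut ha hz)).sub_const _

/-- The conformal invariance estimate behind the Carleson measure of a `BMOA` function. -/
lemma poissonK_mul_deriv_deriv_le (hf : IsAnalytic f) (ha : a ∈ 𝔻) {g : ℂ → ℂ}
    (hg : g = fun z => f (discAut a z) - f a) {z : ℂ} (hz : z ∈ 𝔻) :
    poissonK a z * (‖deriv (deriv f) z‖ ^ 2 * (1 - ‖z‖ ^ 2) ^ 3) ≤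
      poissonK a z ^ 2 * (
        4 * ‖deriv (deriv g) (discAut a z)‖ ^ 2 * (1 - ‖discAut a z‖ ^ 2) ^ 3 +
        8 * (4 * ‖deriv g (discAut a z)‖ ^ 2 * (1 - ‖discAut a z‖ ^ 2))) := by
  have hga : IsAnalytic g := hg ▸ isAnalytic_comp_discAut hf ha
  set φ' : ℂ → ℂ := fun z => -((1 - ‖a‖ ^ 2 : ℝ) : ℂ) / (1 - conj a * z) ^ 2 with hφ'
  set φ'' : ℂ := -((1 - ‖a‖ ^ 2 : ℝ) : ℂ) * (2 * conj a) / (1 - conj a * z) ^ 3 with hφ''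
  -- Since `φ_a` is an involution, `f = g ∘ φ_a + f(a)`, and hence `f'' = (g'' ∘ φ_a) φ_a'² + (g' ∘
  -- φ_a) φ_a''`.
  have hfg : ∀ w ∈ 𝔻, f w = g (discAut a w) + f a := fun w hw => by
    rw [hg]; simp only [discAut_discAut ha hw, sub_add_cancel]
  have hderiv : ∀ w ∈ 𝔻, deriv f w = deriv g (discAut a w) * φ' w := fun w hw => by
    have h1 : f =ᶠ[nhds w] fun w => g (discAut a w) + f a := by
      filter_upwards [isOpen_ball.mem_nhds hw] with v hv using hfg v hv
    rw [h1.deriv_eq]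
    exact (((hga _ (discAut_mem_disc ha hw)).differentiableAt.hasDerivAt.comp w
      (hasDerivAt_discAut ha hw)).add_const (f a)).deriv
  have hderiv2 : deriv (deriv f) z =
      deriv (deriv g) (discAut a z) * φ' z * φ' z + deriv g (discAut a z) * φ'' := by
    have h1 : deriv f =ᶠ[nhds z] fun w => deriv g (discAut a w) * φ' w := by
      filter_upwards [isOpen_ball.mem_nhds hz] with v hv using hderiv v hv
    rw [h1.deriv_eq]
    exact (((isAnalytic_deriv hga _ (discAut_mem_disc ha hz)).differentiableAt.hasDerivAt.comp z
      (hasDerivAt_discAut ha hz)).mul (hasDerivAt_deriv_discAut ha hz)).deriv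
  set P := poissonK a z with hP
  have hP0 : 0 ≤ P := poissonK_nonneg ha z
  have hd := one_sub_normSq_pos hz
  set d := 1 - ‖z‖ ^ 2 with hdd
  set x := ‖deriv (deriv g) (discAut a z)‖ with hx
  set y := ‖deriv g (discAut a z)‖ with hy
  have h1 : ‖deriv (deriv f) z‖ ≤ x * P ^ 2 + y * (4 * P / d) := by
    rw [hderiv2]
    refine (norm_add_le _ _).trans ?_
    rw [norm_mul, norm_mul, norm_mul, norm_deriv_discAut ha, mul_assoc, ← sq]
    gcongr
    exact norm_deriv_deriv_discAut_le ha hz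
  have h2 : ‖deriv (deriv f) z‖ ^ 2 ≤ 2 * (x * P ^ 2) ^ 2 + 2 * (y * (4 * P / d)) ^ 2 := by
    have h3 : ‖deriv (deriv f) z‖ ^ 2 ≤ (x * P ^ 2 + y * (4 * P / d)) ^ 2 := by gcongr
    nlinarith [sq_nonneg (x * P ^ 2 - y * (4 * P / d))]
  rw [one_sub_norm_discAut_sq ha hz]
  calc P * (‖deriv (deriv f) z‖ ^ 2 * d ^ 3)
      ≤ P * ((2 * (x * P ^ 2) ^ 2 + 2 * (y * (4 * P / d)) ^ 2) * d ^ 3) := by gcongr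
    _ = P ^ 2 * (2 * x ^ 2 * (P * d) ^ 3 + 8 * (4 * y ^ 2 * (P * d))) := by
        field_simp
        ring
    -- The coefficient `2` is raised to `4` to match the normalisation of
    -- `lintegral_deriv_deriv_le`.
    _ ≤ P ^ 2 * (4 * x ^ 2 * (P * d) ^ 3 + 8 * (4 * y ^ 2 * (P * d))) := by
        gcongr
        norm_num

/-- For `f ∈ BMOA`, the measure `|f''|² (1 - |z|²)³ dm` has bounded Poisson integral. -/
theorem exists_poisson_bound_of_memBMOA (hf : MemBMOA f) : ∃ M : ℝ, 0 ≤ M ∧ ∀ a ∈ 𝔻,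
    ∫⁻ z in 𝔻, ENNReal.ofReal (poissonK a z * (‖deriv (deriv f) z‖ ^ 2 * (1 - ‖z‖ ^ 2) ^ 3)) ≤
      ENNReal.ofReal M := by
  obtain ⟨hfa, hfin⟩ := hf
  set N := ⨆ a ∈ 𝔻, hardyNormPow 2 (fun z => f (discAut a z) - f a) with hN
  refine ⟨128 * (2 * Real.pi) * N.toReal, by positivity, fun a ha => ?_⟩
  set g : ℂ → ℂ := fun z => f (discAut a z) - f a with hg
  have hga : IsAnalytic g := isAnalytic_comp_discAut hfa ha
  have hgN : hardyNormPow 2 g ≤ N :=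
    le_iSup₂_of_le (f := fun a (_ : a ∈ 𝔻) => hardyNormPow 2 (fun z => f (discAut a z) - f a))
      a ha le_rfl
  set H : ℂ → ℝ≥0∞ := fun w => ENNReal.ofReal (
    4 * ‖deriv (deriv g) w‖ ^ 2 * (1 - ‖w‖ ^ 2) ^ 3 +
        8 * (4 * ‖deriv g w‖ ^ 2 * (1 - ‖w‖ ^ 2))) with hH
  -- The Jacobian of `φ_a` is `|φ_a'|² = P_a²`, exactly the factor in front of the pointwise
  -- estimate.
  have hcv := lintegral_image_holomorphic (S := 𝔻) measurableSet_ball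
    (fun z hz => hasDerivAt_discAut ha hz) (injOn_discAut ha) H
  rw [image_discAut ha] at hcv
  simp_rw [norm_deriv_discAut ha] at hcv
  have hc1 := (isAnalytic_deriv hga).continuousOn
  have hc2 := (isAnalytic_deriv (isAnalytic_deriv hga)).continuousOn
  calc _ ≤ ∫⁻ z in 𝔻, ENNReal.ofReal (poissonK a z ^ 2) * H (discAut a z) := by
        refine setLIntegral_mono' measurableSet_ball fun z hz => ?_
        rw [← ENNReal.ofReal_mul (by positivity)]
        exact ENNReal.ofReal_le_ofReal (poissonK_mul_deriv_deriv_le hfa ha hg hz)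
    _ = ∫⁻ w in 𝔻, H w := hcv.symm
    _ = ∫⁻ w in 𝔻, (ENNReal.ofReal (4 * ‖deriv (deriv g) w‖ ^ 2 * (1 - ‖w‖ ^ 2) ^ 3) +
          8 * ENNReal.ofReal (4 * ‖deriv g w‖ ^ 2 * (1 - ‖w‖ ^ 2))) := by
        refine setLIntegral_congr_fun measurableSet_ball fun w hw => ?_
        have hd := one_sub_normSq_pos hw
        simp only [hH]
        rw [ENNReal.ofReal_add (by positivity) (by positivity),
          ENNReal.ofReal_mul (by norm_num : (0 : ℝ) ≤ 8), ENNReal.ofReal_ofNat]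
    _ = (∫⁻ w in 𝔻, ENNReal.ofReal (4 * ‖deriv (deriv g) w‖ ^ 2 * (1 - ‖w‖ ^ 2) ^ 3)) +
          8 * ∫⁻ w in 𝔻, ENNReal.ofReal (4 * ‖deriv g w‖ ^ 2 * (1 - ‖w‖ ^ 2)) := by
        rw [lintegral_add_left', lintegral_const_mul' _ _ (by simp)]
        refine (ContinuousOn.aemeasurable ?_ measurableSet_ball).ennreal_ofReal
        fun_prop
    _ ≤ 96 * (ENNReal.ofReal (2 * Real.pi) * N) + 8 * (4 * (ENNReal.ofReal (2 * Real.pi) * N)) := by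
        refine add_le_add ((lintegral_deriv_deriv_le hga).trans ?_)
          (mul_le_mul_right ((lintegral_deriv_le hga).trans ?_) _) <;> gcongr
    _ = ENNReal.ofReal (128 * (2 * Real.pi) * N.toReal) := by
        rw [ENNReal.ofReal_mul (p := 128 * (2 * Real.pi)) (by positivity),
          ENNReal.ofReal_mul (p := 128) (by positivity), ENNReal.ofReal_toReal hfin.ne,
          ENNReal.ofReal_ofNat]
        ring

end BMOA

/-! ### Poisson sums over the sequence and the exceptional discs -/

lemma integral_poissonKernel {w : ℂ} (hw : w ∈ 𝔻) :
    ∫ θ in (0 : ℝ)..2 * Real.pi, poissonKernel 0 w (circleMap 0 1 θ) = 2 * Real.pi := by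
  have h := (diffContOnCl_const (𝕜 := ℂ) (c := (1 : ℝ) • (1 : ℂ))
    (s := ball (0 : ℂ) 1)).circleAverage_poissonKernel_smul hw
  rw [Real.circleAverage_def, inv_smul_eq_iff₀ Real.two_pi_pos.ne'] at h
  simp only [one_smul, Pi.smul_apply', Complex.real_smul, mul_one] at h
  rw [intervalIntegral.integral_ofReal] at h
  exact_mod_cast h

/-- On the unit circle `|1 - ā r e^{iθ}| = |e^{iθ} - r a|`, so the squared modulus of the function
is the Poisson kernel at `r a` divided by `1 - |r a|² ≥ 1 - |a|²`, and the Poisson kernel has mean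
`1`. -/
lemma hardyNormPow_kernel_le {a : ℂ} (ha : a ∈ 𝔻) :
    hardyNormPow 2 (fun z => (1 - conj a * z)⁻¹) ≤ ENNReal.ofReal (1 / (1 - ‖a‖ ^ 2)) := by
  refine iSup₂_le fun r hr => ?_
  set w : ℂ := r * a with hw
  have hd := one_sub_normSq_pos ha
  have hwa : ‖w‖ ≤ ‖a‖ := by
    rw [hw, norm_mul, Complex.norm_real, Real.norm_of_nonneg hr.1]
    exact mul_le_of_le_one_left (norm_nonneg _) hr.2.le
  have hwD : w ∈ 𝔻 := mem_disc_iff.2 (hwa.trans_lt (mem_disc_iff.1 ha))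
  have hwd := one_sub_normSq_pos hwD
  have hnorm : ∀ θ : ℝ, ‖1 - conj a * circleMap 0 r θ‖ = ‖circleMap 0 1 θ - w‖ := fun θ => by
    have h1 : ‖circleMap 0 1 θ‖ = 1 := by simp
    have h2 : 1 - conj a * circleMap 0 r θ = conj (circleMap 0 1 θ - w) * circleMap 0 1 θ := by
      rw [map_sub, sub_mul, Complex.conj_mul', h1, hw]
      simp only [circleMap, map_mul, Complex.conj_ofReal, zero_add]
      push_cast
      ring
    rw [h2, norm_mul, RCLike.norm_conj, h1, mul_one]
  have hne : ∀ θ : ℝ, 0 < ‖circleMap 0 1 θ - w‖ := fun θ => by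
    rw [← hnorm]
    refine norm_one_sub_pos (mem_disc_iff.1 ha).le (mem_disc_iff.2 ?_)
    rw [norm_circleMap_zero, abs_of_nonneg hr.1]
    exact hr.2
  have hker : ∀ θ : ℝ, ‖(1 - conj a * circleMap 0 r θ)⁻¹‖ₑ ^ (2 : ℝ) ≤
      ENNReal.ofReal (1 / (1 - ‖a‖ ^ 2)) *
        ENNReal.ofReal (poissonKernel 0 w (circleMap 0 1 θ)) := fun θ => by
    rw [← ENNReal.ofReal_mul (by positivity), ← ofReal_norm,
      ENNReal.ofReal_rpow_of_nonneg (norm_nonneg _) two_pos.le, Real.rpow_two, norm_inv, hnorm,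
      poissonKernel_def]
    apply ENNReal.ofReal_le_ofReal
    have h1 : ‖circleMap 0 1 θ‖ = 1 := by simp
    have h2 := hne θ
    rw [sub_zero, sub_zero, h1, div_mul_div_comm, inv_pow, inv_eq_one_div,
      div_le_div_iff₀ (by positivity) (by positivity)]
    have h3 : 1 - ‖a‖ ^ 2 ≤ 1 - ‖w‖ ^ 2 := by gcongr
    have h4 : 0 ≤ ‖circleMap 0 1 θ - w‖ ^ 2 := by positivity
    nlinarith
  have hcont : Continuous fun θ : ℝ => poissonKernel 0 w (circleMap 0 1 θ) := by
    unfold poissonKernel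
    refine Continuous.div (by fun_prop) (by fun_prop) fun θ => ?_
    simpa using (norm_pos_iff.1 (hne θ))
  have hnn : ∀ θ : ℝ, 0 ≤ poissonKernel 0 w (circleMap 0 1 θ) := fun θ => by
    rw [poissonKernel_def]
    refine div_nonneg ?_ (by positivity)
    simpa using hwd.le
  calc integralMean 2 (fun z => (1 - conj a * z)⁻¹) r
      ≤ (ENNReal.ofReal (2 * Real.pi))⁻¹ * ∫⁻ θ in Icc 0 (2 * Real.pi),
          ENNReal.ofReal (1 / (1 - ‖a‖ ^ 2)) *
            ENNReal.ofReal (poissonKernel 0 w (circleMap 0 1 θ)) := by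
        rw [integralMean]
        gcongr with θ
        exact hker θ
    _ = (ENNReal.ofReal (2 * Real.pi))⁻¹ * (ENNReal.ofReal (1 / (1 - ‖a‖ ^ 2)) *
          ENNReal.ofReal (2 * Real.pi)) := by
        have hI := integral_poissonKernel hwD
        rw [intervalIntegral.integral_of_le Real.two_pi_pos.le, ← integral_Icc_eq_integral_Ioc] at hI
        rw [lintegral_const_mul' _ _ ENNReal.ofReal_ne_top,
          ← ofReal_integral_eq_lintegral_ofReal hcont.integrableOn_Icc (.of_forall hnn), hI]
    _ = _ := by
        rw [mul_comm, mul_assoc, ENNReal.mul_inv_cancel (by simp [Real.pi_pos])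
          ENNReal.ofReal_ne_top, mul_one]

/-- The Poisson sums of a uniformly separated sequence are bounded. -/
lemma exists_poisson_bound_of_uniformlySeparated {ι : Type*} {z : ι → ℂ} (hz : ∀ i, z i ∈ 𝔻)
    (h : UniformlySeparated z) : ∃ C : ℝ≥0, ∀ a ∈ 𝔻,
      ∑' i, ENNReal.ofReal ((1 - ‖z i‖) * poissonK a (z i)) ≤ C := by
  -- The Carleson condition is tested with `p = 2` on `1 / (1 - ā z)`; multiplied by `1 - |a|²`, its
  -- squared modulus is `P_a`.
  obtain ⟨C, -, hC⟩ := h.2 2 two_pos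
  refine ⟨C, fun a ha => ?_⟩
  have hd := one_sub_normSq_pos ha
  have h1 := hC (fun z => (1 - conj a * z)⁻¹)
    (isAnalytic_of_hasDerivAt fun z hz => hasDerivAt_kernel ha hz)
  rw [Measure.restrict_sum _ measurableSet_ball, lintegral_sum_measure] at h1
  have h2 : ∀ i, ENNReal.ofReal ((1 - ‖z i‖) * poissonK a (z i)) =
      ENNReal.ofReal (1 - ‖a‖ ^ 2) * ∫⁻ w in 𝔻, ‖(1 - conj a * w)⁻¹‖ₑ ^ (2 : ℝ)
        ∂(ENNReal.ofReal (1 - ‖z i‖) • Measure.dirac (z i)) := fun i => by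
    classical
    have hzi := mem_disc_iff.1 (hz i)
    rw [setLIntegral_smul_measure, setLIntegral_dirac, if_pos (hz i), smul_eq_mul, ← ofReal_norm,
      ENNReal.ofReal_rpow_of_nonneg (norm_nonneg _) two_pos.le, Real.rpow_two, norm_inv,
      ← ENNReal.ofReal_mul (by linarith), ← ENNReal.ofReal_mul hd.le, poissonK]
    congr 1
    ring
  simp_rw [h2]
  rw [ENNReal.tsum_mul_left]
  calc _ ≤ ENNReal.ofReal (1 - ‖a‖ ^ 2) * (C * ENNReal.ofReal (1 / (1 - ‖a‖ ^ 2))) := by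
        refine mul_le_mul_right (h1.trans ?_) _
        exact mul_le_mul_right (hardyNormPow_kernel_le ha) _
    _ = C := by
        rw [mul_left_comm, ← ENNReal.ofReal_mul hd.le, mul_one_div_cancel hd.ne',
          ENNReal.ofReal_one, mul_one]

/-- On a pseudo-hyperbolic disc, the growth condition bounds the Poisson integral of the density. -/
lemma lintegral_pseudoDisc_le {A : ℂ → ℂ} {M : ℝ}
    (hM : ∀ z ∈ 𝔻, ‖A z‖ * (1 - ‖z‖ ^ 2) ^ 2 ≤ M) {δ : ℝ} (hδ₀ : 0 < δ) (hδ₁ : δ < 1) {a v : ℂ}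
    (ha : a ∈ 𝔻) (hv : v ∈ 𝔻) :
    ∫⁻ z in pseudoDisc v δ, ENNReal.ofReal (poissonK a z * coeffDensity A z) ≤
      ENNReal.ofReal (2 * M ^ 2 * harnackConst δ ^ 3 * (δ / (1 - δ)) ^ 2 * Real.pi) *
        ENNReal.ofReal ((1 - ‖v‖) * poissonK a v) := by
  set K := harnackConst δ with hK
  have hK1 : 1 ≤ K := one_le_harnackConst hδ₀ hδ₁
  set d := 1 - ‖v‖ ^ 2 with hd
  have hd0 : 0 < d := one_sub_normSq_pos hv
  set q := δ / (1 - δ) with hq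
  have hq0 : 0 < q := div_pos hδ₀ (by linarith)
  have hP0 := poissonK_nonneg ha v
  have hv1 := mem_disc_iff.1 hv
  have hpt : ∀ z ∈ pseudoDisc v δ, poissonK a z * coeffDensity A z ≤
      K ^ 3 * M ^ 2 * poissonK a v / d := by
    intro z hz
    have h1 := poissonK_le_of_mem_pseudoDisc hδ₀ hδ₁ ha hz.1 (mem_pseudoDisc_symm hv hz)
    have h2 := one_sub_normSq_le_of_mem_pseudoDisc hδ₀ hδ₁ hv hz
    have h3 := hM z hz.1
    have h4 := one_sub_normSq_pos hz.1
    -- The density is `(|A| (1 - |z|²)²)² / (1 - |z|²)`. The remaining factor `1 / d` against an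
    -- area of order `d²` leaves `d`, comparable to `1 - |v|`.
    have h5 : coeffDensity A z ≤ M ^ 2 * (K / d) := by
      have h6 : (‖A z‖ * (1 - ‖z‖ ^ 2) ^ 2) ^ 2 ≤ M ^ 2 := by gcongr
      have h7 : 1 / (1 - ‖z‖ ^ 2) ≤ K / d := by
        rw [div_le_div_iff₀ h4 hd0]; linarith
      calc coeffDensity A z = (‖A z‖ * (1 - ‖z‖ ^ 2) ^ 2) ^ 2 * (1 / (1 - ‖z‖ ^ 2)) := by
            rw [coeffDensity]; field_simp
        _ ≤ _ := by gcongr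
    calc poissonK a z * coeffDensity A z ≤ (K ^ 2 * poissonK a v) * (M ^ 2 * (K / d)) :=
          mul_le_mul h1 h5 (coeffDensity_nonneg A hz.1) (by positivity)
      _ = _ := by ring
  have hvol : volume (pseudoDisc v δ) ≤ ENNReal.ofReal (q * d) ^ 2 * ENNReal.ofReal Real.pi := by
    refine (measure_mono (t := closedBall v (q * d)) fun z hz => ?_).trans (le_of_eq ?_)
    · rw [mem_closedBall, dist_eq_norm]
      exact norm_sub_le_of_mem_pseudoDisc hδ₀ hδ₁ hv hz
    · rw [Complex.volume_closedBall, ← ENNReal.ofReal_coe_nnreal, NNReal.coe_real_pi]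
  calc _ ≤ ∫⁻ _ in pseudoDisc v δ, ENNReal.ofReal (K ^ 3 * M ^ 2 * poissonK a v / d) :=
        setLIntegral_mono' (isOpen_pseudoDisc hv).measurableSet fun z hz =>
          ENNReal.ofReal_le_ofReal (hpt z hz)
    _ ≤ ENNReal.ofReal (K ^ 3 * M ^ 2 * poissonK a v / d) *
          (ENNReal.ofReal (q * d) ^ 2 * ENNReal.ofReal Real.pi) := by
        rw [setLIntegral_const]
        gcongr
    _ ≤ _ := by
        rw [← ENNReal.ofReal_pow (by positivity), ← ENNReal.ofReal_mul (by positivity),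
          ← ENNReal.ofReal_mul (by positivity), ← ENNReal.ofReal_mul (by positivity)]
        apply ENNReal.ofReal_le_ofReal
        have h8 : d ≤ 2 * (1 - ‖v‖) := by rw [hd]; nlinarith [norm_nonneg v]
        calc _ = M ^ 2 * K ^ 3 * q ^ 2 * Real.pi * poissonK a v * d := by field_simp
          _ ≤ M ^ 2 * K ^ 3 * q ^ 2 * Real.pi * poissonK a v * (2 * (1 - ‖v‖)) := by gcongr
          _ = _ := by ring

theorem mainTheorem11 (A f₁ f₂ : ℂ → ℂ) (hA : IsAnalytic A)
    (hf₁ : IsSolution A f₁) (hf₂ : IsSolution A f₂) (hlin : LinIndep f₁ f₂)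
    (hB₁ : MemBloch f₁) (hB₂ : MemBloch f₂)
    {ι : Type*} [Countable ι] (z : ι → ℂ) (hz : ∀ i, z i ∈ 𝔻)
    (δ : ℝ) (hδ₀ : 0 < δ) (hδ₁ : δ < 1)
    (hdisj : Pairwise fun i j => Disjoint (pseudoDisc (z i) δ) (pseudoDisc (z j) δ))
    (hlower : ∃ c : ℝ, 0 < c ∧ ∀ w ∈ 𝔻 \ ⋃ i, pseudoDisc (z i) δ, c ≤ ‖f₁ w‖ + ‖f₂ w‖) :
    MemHInfty 2 A ∧
      (MemBMOA f₁ → MemBMOA f₂ → UniformlySeparated z → IsCarleson (coeffMeasure A)) := by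
  obtain ⟨c, hc, hlow⟩ := hlower
  have hgrowth := memHInfty_coeff hA hf₁ hf₂ hB₁ hB₂ hz hδ₀ hδ₁ hdisj hc hlow
  refine ⟨hgrowth, fun hb₁ hb₂ hsep => ?_⟩
  obtain ⟨M, hM⟩ := hgrowth.2
  simp only [Real.rpow_two] at hM
  obtain ⟨N₁, hN₁0, hN₁⟩ := exists_poisson_bound_of_memBMOA hb₁
  obtain ⟨N₂, hN₂0, hN₂⟩ := exists_poisson_bound_of_memBMOA hb₂
  obtain ⟨C, hC⟩ := exists_poisson_bound_of_uniformlySeparated hz hsep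
  set L := 2 * M ^ 2 * harnackConst δ ^ 3 * (δ / (1 - δ)) ^ 2 * Real.pi with hL
  have hL0 : 0 ≤ L := by
    have := one_le_harnackConst hδ₀ hδ₁
    positivity
  refine isCarleson_coeffMeasure hA (M := L * C + 2 / c ^ 2 * (N₁ + N₂)) fun a ha => ?_
  set U := ⋃ i, pseudoDisc (z i) δ with hU
  have hUm : MeasurableSet U := MeasurableSet.iUnion fun i => (isOpen_pseudoDisc (hz i)).measurableSet
  -- Each disc contributes at most `L` times one term of the Poisson sum of the sequence.
  have hin : ∫⁻ w in U, ENNReal.ofReal (poissonK a w * coeffDensity A w) ≤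
      ENNReal.ofReal (L * C) := by
    calc _ ≤ ∑' i, ∫⁻ w in pseudoDisc (z i) δ,
            ENNReal.ofReal (poissonK a w * coeffDensity A w) := lintegral_iUnion_le _ _
      _ ≤ ∑' i, ENNReal.ofReal L * ENNReal.ofReal ((1 - ‖z i‖) * poissonK a (z i)) :=
          ENNReal.tsum_le_tsum fun i => lintegral_pseudoDisc_le hM hδ₀ hδ₁ ha (hz i)
      _ ≤ ENNReal.ofReal L * C := by
          rw [ENNReal.tsum_mul_left]
          exact mul_le_mul_right (hC a ha) _
      _ = _ := by rw [ENNReal.ofReal_mul hL0, ENNReal.ofReal_coe_nnreal]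
  -- Here `c |A| ≤ |f₁''| + |f₂''|`, and squaring gives the factor `2 / c ^ 2`.
  have hout : ∫⁻ w in 𝔻 \ U, ENNReal.ofReal (poissonK a w * coeffDensity A w) ≤
      ENNReal.ofReal (2 / c ^ 2 * (N₁ + N₂)) := by
    set F₁ : ℂ → ℝ := fun w =>
      poissonK a w * (‖deriv (deriv f₁) w‖ ^ 2 * (1 - ‖w‖ ^ 2) ^ 3) with hF₁
    set F₂ : ℂ → ℝ := fun w =>
      poissonK a w * (‖deriv (deriv f₂) w‖ ^ 2 * (1 - ‖w‖ ^ 2) ^ 3) with hF₂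
    have hF₁m : AEMeasurable (fun w => ENNReal.ofReal (F₁ w)) (volume.restrict 𝔻) := by
      have h1 := continuousOn_poissonK ha
      have h2 := (isAnalytic_deriv (isAnalytic_deriv hf₁.1)).continuousOn
      refine (ContinuousOn.aemeasurable ?_ measurableSet_ball).ennreal_ofReal
      exact h1.mul (by fun_prop)
    calc _ ≤ ∫⁻ w in 𝔻 \ U, ENNReal.ofReal (2 / c ^ 2) *
            (ENNReal.ofReal (F₁ w) + ENNReal.ofReal (F₂ w)) := by
          refine setLIntegral_mono' (measurableSet_ball.diff hUm) fun w hw => ?_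
          have hP := poissonK_nonneg ha w
          have hd := one_sub_normSq_pos hw.1
          rw [← ENNReal.ofReal_add (by positivity) (by positivity),
            ← ENNReal.ofReal_mul (by positivity)]
          apply ENNReal.ofReal_le_ofReal
          have h1 := mul_norm_coeff_le hf₁ hf₂ hw.1 (hlow w hw)
          set x := ‖deriv (deriv f₁) w‖
          set y := ‖deriv (deriv f₂) w‖
          have h2 : ‖A w‖ ^ 2 ≤ 2 / c ^ 2 * (x ^ 2 + y ^ 2) := by
            have h3 : (c * ‖A w‖) ^ 2 ≤ (x + y) ^ 2 := by gcongr
            rw [div_mul_eq_mul_div, le_div_iff₀ (by positivity)]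
            nlinarith [sq_nonneg (x - y)]
          calc poissonK a w * coeffDensity A w ≤
                poissonK a w * (2 / c ^ 2 * (x ^ 2 + y ^ 2) * (1 - ‖w‖ ^ 2) ^ 3) := by
                unfold coeffDensity; gcongr
            _ = _ := by simp only [hF₁, hF₂]; ring
      _ ≤ ∫⁻ w in 𝔻, ENNReal.ofReal (2 / c ^ 2) *
            (ENNReal.ofReal (F₁ w) + ENNReal.ofReal (F₂ w)) := lintegral_mono_set sdiff_subset
      _ = ENNReal.ofReal (2 / c ^ 2) * ((∫⁻ w in 𝔻, ENNReal.ofReal (F₁ w)) +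
            ∫⁻ w in 𝔻, ENNReal.ofReal (F₂ w)) := by
          rw [lintegral_const_mul' _ _ ENNReal.ofReal_ne_top, lintegral_add_left' hF₁m]
      _ ≤ ENNReal.ofReal (2 / c ^ 2) * (ENNReal.ofReal N₁ + ENNReal.ofReal N₂) :=
          mul_le_mul_right (add_le_add (hN₁ a ha) (hN₂ a ha)) _
      _ = _ := by rw [← ENNReal.ofReal_add hN₁0 hN₂0, ← ENNReal.ofReal_mul (by positivity)]
  have hUD : 𝔻 ⊆ U ∪ 𝔻 \ U := fun w hw => by
    by_cases h : w ∈ U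
    · exact Or.inl h
    · exact Or.inr ⟨hw, h⟩
  calc _ ≤ ∫⁻ w in U ∪ 𝔻 \ U, ENNReal.ofReal (poissonK a w * coeffDensity A w) :=
        lintegral_mono_set hUD
    _ ≤ _ := lintegral_union_le _ _ _
    _ ≤ _ := add_le_add hin hout
    _ = _ := by rw [← ENNReal.ofReal_add (by positivity) (by positivity)]
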